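/- **Theorem (MLE lower bound).** Let $\mathcal X=[-1/2,1/2]$, $\mathcal Y=\{0,1\}$, and identify a function $f:\mathcal X\to[0,1]$ with the conditional density under which $y\mid x\sim\mathrm{Ber}(f(x))$. For $a,b\in[0,1]$ let $$d_{\mathrm H}^2(a,b)=\tfrac12\big[(\sqrt a-\sqrt b)^2+(\sqrt{1-a}-\sqrt{1-b})^2\big].$$ For a class $\mathcal F$ of such (measurable) functions, a maximum likelihood estimate (MLE) on a sample $(x_{1:n},y_{1:n})\in\mathcal X^n\times\mathcal Y^n$ is any $\hat f_n\in\mathcal F$ that maximizes $\sum_{t=1}^n\big[y_t\log f(x_t)+(1-y_t)\log(1-f(x_t))\big]$ over $f\in\mathcal F$. The KL risk at $(f^*,\mu)$ of a map $\hat g_n$ that assigns to each sample of size $n$ a measurable function $\mathcal X\to[0,1]$ is $$R_n(\hat g;f^*,\mu)=\mathbb E_{x_{1:n}\sim\mu^{\otimes n}}\,\mathbb E_{y_{1:n}\sim\bigotimes_t\mathrm{Ber}(f^*(x_t))}\,\mathbb E_{x\sim\mu}\,\mathrm{KL}\big(\mathrm{Ber}(f^*(x))\,\|\,\mathrm{Ber}(\hat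 g_n(x))\big),$$ and the minimax risk of $\mathcal F$ is $\mathcal R_n(\mathcal F)=\inf_{\hat g}\sup_{\mu}\sup_{f^*\in\mathcal F}R_n(\hat g;f^*,\mu)$, where $\hat g$ ranges over all estimators ($\hat g_n(x)\in[0,1]$ jointly measurable in the sample and $x$) and $\mu$ over all Borel probability measures on $\mathcal X$. For every $\gamma\in(0,1/2)$ there exists a convex class $\overline\Gamma_\gamma$ of functions $f:[-1/2,1/2]\to[7/16,9/16]$, each satisfying $|f(x)-f(x')|\le|x-x'|^\gamma$ for all $x,x'$, such that $\overline\Gamma_\gamma$ contains the constant function $1/2$, an MLE over $\overline\Gamma_\gamma$ exists on every sample, and the following hold. 1. If $x_{1:n}\sim\mathrm{Unif}[-1/2,1/2]^{\otimes n}$ and $y_{1:n}\sim\mathrm{Ber}(1/2)^{\otimes n}$ independently for every $n\in\mathbb N$, then for every $\delta>0$ there exists $C>0$ such that $$\liminf_{n\to\infty}\ \mathbb P_{x_{1:n},y_{1:n}}\Big[\,\mathbb E_{x\sim\mathrm{Unif}[-1/2,1/2]}\,d_{\mathrm H}^2\big(1/2,\hat f_n(x)\big)\ \ge\ C\,(n\log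 n)^{-\gamma}\ \text{ for every MLE }\hat f_n\text{ over }\overline\Gamma_\gamma\Big]\ \ge\ 1-\delta$$ (inner probability, should the event not be measurable). 2. The model is well specified, yet the MLE does not achieve the minimax rate: there is $K>0$ with $\mathcal R_n(\overline\Gamma_\gamma)\le K\,n^{-2\gamma/(2\gamma+1)}$ for all $n\ge1$, and for every choice $(\hat f_n)_n$ of MLEs over $\overline\Gamma_\gamma$ and every $M\ge0$, $$R_n\big(\hat f;\,1/2,\,\mathrm{Unif}[-1/2,1/2]\big)>M\,\mathcal R_n(\overline\Gamma_\gamma)\qquad\text{for all sufficiently large }n,$$ where the expectation over the sample is read as a lower integral if the choice is not measurable. -/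

import Mathlib

open MeasureTheory Filter
open scoped ENNReal

noncomputable section

namespace CondDensity

/-- The covariate space `[-1/2, 1/2]`. -/
abbrev Covariate : Type := Set.Icc (-1 / 2 : ℝ) (1 / 2)

/-- The uniform distribution on `[-1/2, 1/2]`: Lebesgue measure (the interval has length one). -/
def unif : Measure Covariate := (volume : Measure ℝ).comap Subtype.val

instance : IsProbabilityMeasure unif := by
  constructor
  rw [unif, comap_subtype_coe_apply measurableSet_Icc]
  simp only [Set.image_univ, Subtype.range_coe_subtype, Set.ofPred_mem_eq, Real.volume_Icc]
  norm_num

/-- The Bernoulli distribution on the response space `Bool` (`true` is the response `1`) with mean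
`a ∈ [0,1]`. Values of `a` outside `[0,1]` are clipped; they do not occur below. -/
def bern (a : ℝ) : Measure Bool :=
  ProbabilityTheory.bernoulliMeasure true false (Set.projIcc 0 1 zero_le_one a)

/-- The density of `Ber(a)` with respect to the counting measure on `{0,1}`. -/
def bernDensity (a : ℝ) (y : Bool) : ℝ := if y then a else 1 - a

/-- Squared Hellinger distance between `Ber(a)` and `Ber(b)`, scaled to take values in `[0,1]`. -/
def hellingerSq (a b : ℝ) : ℝ :=
  (1 / 2) * ∑ y : Bool, (√(bernDensity a y) - √(bernDensity b y)) ^ 2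

/-- Log-likelihood of the conditional density `x ↦ Ber(f x)` on a sample of size `n`. -/
def logLik {n : ℕ} (x : Fin n → Covariate) (y : Fin n → Bool) (f : Covariate → ℝ) : ℝ :=
  ∑ t, Real.log (bernDensity (f (x t)) (y t))

/-- `f` is a maximum likelihood estimate over the class `F` on the sample `(x, y)`. -/
def IsMLE (F : Set (Covariate → ℝ)) {n : ℕ} (x : Fin n → Covariate) (y : Fin n → Bool)
    (f : Covariate → ℝ) : Prop :=
  f ∈ F ∧ ∀ g ∈ F, logLik x y g ≤ logLik x y f

/-- `E_{x ∼ Unif[-1/2,1/2]} d_H²(1/2, f(x))`. -/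
def hellingerLoss (f : Covariate → ℝ) : ℝ := ∫ x, hellingerSq (1 / 2) (f x) ∂unif

/-- The law of `(x_{1:n}, y_{1:n})` with `x_{1:n} ∼ Unif[-1/2,1/2]^{⊗n}` and
`y_{1:n} ∼ Ber(1/2)^{⊗n}` independent. -/
def fairLaw (n : ℕ) : Measure ((Fin n → Covariate) × (Fin n → Bool)) :=
  (Measure.pi fun _ => unif).prod (Measure.pi fun _ => bern (1 / 2))

/-- Inner probability of an event: it equals `P E` if `E` is measurable, and never exceeds `P E`
(Mathlib's `P E` is the outer probability for non-measurable `E`). -/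
def innerProb {Ω : Type*} [MeasurableSpace Ω] (P : Measure Ω) (E : Set Ω) : ℝ≥0∞ := 1 - P Eᶜ

/-- KL loss `E_{x ∼ μ} KL(Ber(f(x)) ‖ Ber(g(x)))` of the estimate `g` when the truth is `f`. -/
def klLoss (μ : Measure Covariate) (f g : Covariate → ℝ) : ℝ≥0∞ :=
  ∫⁻ x, InformationTheory.klDiv (bern (f x)) (bern (g x)) ∂μ

/-- KL risk `E_{x_{1:n} ∼ μ} E_{y_{1:n} ∼ f(x_{1:n})}` of the KL loss of the estimate
`e x_{1:n} y_{1:n}`, when the covariate distribution is `μ` and the true conditional density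
is `f`. -/
def klRisk {n : ℕ} (e : (Fin n → Covariate) → (Fin n → Bool) → Covariate → ℝ)
    (μ : Measure Covariate) (f : Covariate → ℝ) : ℝ≥0∞ :=
  ∫⁻ x, ∫⁻ y, klLoss μ f (e x y) ∂(Measure.pi fun t => bern (f (x t))) ∂(Measure.pi fun _ => μ)

/-- Estimators from samples of size `n`: jointly measurable, with values in the Bernoulli
conditional densities. -/
structure IsEstimator {n : ℕ}
    (e : (Fin n → Covariate) → (Fin n → Bool) → Covariate → ℝ) : Prop where
  mem_Icc : ∀ x y z, e x y z ∈ Set.Icc (0 : ℝ) 1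
  measurable : Measurable
    fun p : ((Fin n → Covariate) × (Fin n → Bool)) × Covariate => e p.1.1 p.1.2 p.2

/-- Minimax KL risk of the class `F`: infimum over estimators of the supremum over all covariate
distributions and all true conditional densities in `F`. -/
def minimaxRisk (F : Set (Covariate → ℝ)) (n : ℕ) : ℝ≥0∞ :=
  ⨅ (e : (Fin n → Covariate) → (Fin n → Bool) → Covariate → ℝ) (_ : IsEstimator e),
    ⨆ (μ : Measure Covariate) (_ : IsProbabilityMeasure μ), ⨆ f ∈ F, klRisk e μ f

end CondDensity

end

/-!
In the class considered here a function may oscillate only in proportion to its offset from the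
truth `1 / 2`, so every attempt to fit the noise has to be paid for by a constant bias. Most points
of a uniform sample of size `n` are isolated at the scale `ρ ≍ 1 / n`, and fitting the signs of the
responses there by spikes of height `ρ ^ γ`, at the price of an offset of order `ρ ^ (γ / 2)`,
raises the log-likelihood by an amount of order `n ρ ^ γ`. On the other hand, chaining over dyadic
bins bounds the gain of any member of the class by its offset times a sum of order
`n ρ ^ (γ / 2)`. A maximum likelihood estimate therefore has an offset of order at least
`n ^ (-γ / 2)`, hence a Hellinger loss of order at least `n ^ (-γ)`, whereas the mean response on
bins of length `n ^ (-1 / (2 γ + 1))` attains the risk `n ^ (-2 γ / (2 γ + 1))`.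
-/

noncomputable section

open InformationTheory

namespace CondDensity

/-! ### Bernoulli measures -/

instance (a : ℝ) : IsProbabilityMeasure (bern a) := by
  unfold bern
  infer_instance

lemma bern_eq_sum_dirac {a : ℝ} (ha : a ∈ Set.Icc (0 : ℝ) 1) :
    bern a = ∑ y, ENNReal.ofReal (bernDensity a y) • Measure.dirac y := by
  rw [bern, ProbabilityTheory.bernoulliMeasure_def, Set.projIcc_of_mem zero_le_one ha]
  have htrue : unitInterval.toNNReal ⟨a, ha⟩ = a.toNNReal :=
    NNReal.eq (by simp [ha.1])
  have hfalse : unitInterval.toNNReal (unitInterval.symm ⟨a, ha⟩) = (1 - a).toNNReal :=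
    NNReal.eq (by simp [ha.2])
  rw [htrue, hfalse, Fintype.sum_bool]
  rfl

lemma bernDensity_nonneg {a : ℝ} (ha : a ∈ Set.Icc (0 : ℝ) 1) (y : Bool) :
    0 ≤ bernDensity a y := by
  cases y
  · exact sub_nonneg.2 ha.2
  · exact ha.1

lemma bernDensity_pos {a : ℝ} (ha : a ∈ Set.Ioo (0 : ℝ) 1) (y : Bool) : 0 < bernDensity a y := by
  cases y
  · exact sub_pos.2 ha.2
  · exact ha.1

lemma lintegral_bern {a : ℝ} (ha : a ∈ Set.Icc (0 : ℝ) 1) (φ : Bool → ℝ≥0∞) :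
    ∫⁻ y, φ y ∂(bern a) = ∑ y, ENNReal.ofReal (bernDensity a y) * φ y := by
  simp only [bern_eq_sum_dirac ha, lintegral_finsetSum_measure, lintegral_smul_measure,
    lintegral_dirac, smul_eq_mul]

lemma integral_bern {a : ℝ} (ha : a ∈ Set.Icc (0 : ℝ) 1) (φ : Bool → ℝ) :
    ∫ y, φ y ∂(bern a) = ∑ y, bernDensity a y * φ y := by
  rw [bern, ProbabilityTheory.integral_bernoulliMeasure, Set.projIcc_of_mem zero_le_one ha]
  simp [bernDensity]

lemma bern_eq_withDensity_bern {a b : ℝ} (ha : a ∈ Set.Icc (0 : ℝ) 1)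
    (hb : b ∈ Set.Ioo (0 : ℝ) 1) :
    bern a =
      (bern b).withDensity fun y => ENNReal.ofReal (bernDensity a y / bernDensity b y) := by
  refine Measure.ext_of_lintegral _ fun φ hφ => ?_
  rw [lintegral_withDensity_eq_lintegral_mul _ (measurable_of_finite _) hφ, lintegral_bern ha,
    lintegral_bern (Set.Ioo_subset_Icc_self hb)]
  refine Finset.sum_congr rfl fun y _ => ?_
  rw [Pi.mul_apply, ← mul_assoc, ← ENNReal.ofReal_mul (bernDensity_pos hb y).le,
    mul_div_cancel₀ _ (bernDensity_pos hb y).ne']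

lemma klDiv_bern {a b : ℝ} (ha : a ∈ Set.Icc (0 : ℝ) 1) (hb : b ∈ Set.Ioo (0 : ℝ) 1) :
    klDiv (bern a) (bern b) =
      ENNReal.ofReal (∑ y, bernDensity b y * klFun (bernDensity a y / bernDensity b y)) := by
  have hwd := bern_eq_withDensity_bern ha hb
  have hac : bern a ≪ bern b := hwd ▸ withDensity_absolutelyContinuous _ _
  have hrn : (bern a).rnDeriv (bern b) =ᵐ[bern b]
      fun y => ENNReal.ofReal (bernDensity a y / bernDensity b y) := by
    conv_lhs => rw [hwd]
    exact Measure.rnDeriv_withDensity _ (measurable_of_finite _)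
  have hratio (y : Bool) : 0 ≤ bernDensity a y / bernDensity b y :=
    div_nonneg (bernDensity_nonneg ha y) (bernDensity_pos hb y).le
  rw [klDiv_eq_lintegral_klFun_of_ac hac, lintegral_congr_ae (hrn.mono fun y hy => by rw [hy]),
    lintegral_bern (Set.Ioo_subset_Icc_self hb), ENNReal.ofReal_sum_of_nonneg fun y _ =>
      mul_nonneg (bernDensity_pos hb y).le (klFun_nonneg (hratio y))]
  refine Finset.sum_congr rfl fun y _ => ?_
  rw [ENNReal.toReal_ofReal (hratio y), ENNReal.ofReal_mul (bernDensity_pos hb y).le]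

/-! ### Kullback–Leibler, chi-square and Hellinger divergences -/

lemma klFun_le_sq {u : ℝ} (hu : 0 ≤ u) : klFun u ≤ (u - 1) ^ 2 := by
  rcases hu.eq_or_lt with rfl | hu
  · simp [klFun_zero]
  · rw [klFun_apply]
    nlinarith [Real.log_le_sub_one_of_pos hu]

lemma sq_sqrt_sub_one_le_klFun {u : ℝ} (hu : 0 ≤ u) : (√u - 1) ^ 2 ≤ klFun u := by
  rcases hu.eq_or_lt with rfl | hu
  · simp [klFun_zero]
  have hlog : 1 - (√u)⁻¹ ≤ Real.log u / 2 := by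
    rw [← Real.log_sqrt hu.le]
    exact Real.one_sub_inv_le_log_of_pos (Real.sqrt_pos.2 hu)
  have hmul : u - √u ≤ u * (Real.log u / 2) := by
    calc u - √u = u * (1 - (√u)⁻¹) := by rw [mul_sub, mul_one, ← div_eq_mul_inv, Real.div_sqrt]
      _ ≤ u * (Real.log u / 2) := mul_le_mul_of_nonneg_left hlog hu.le
  rw [klFun_apply, sub_sq, Real.sq_sqrt hu.le]
  linarith

lemma klDiv_bern_le_chiSq {a b : ℝ} (ha : a ∈ Set.Icc (0 : ℝ) 1) (hb : b ∈ Set.Ioo (0 : ℝ) 1) :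
    klDiv (bern a) (bern b) ≤ ENNReal.ofReal ((a - b) ^ 2 / (b * (1 - b))) := by
  rw [klDiv_bern ha hb]
  refine ENNReal.ofReal_le_ofReal ?_
  calc ∑ y, bernDensity b y * klFun (bernDensity a y / bernDensity b y)
      ≤ ∑ y, bernDensity b y * (bernDensity a y / bernDensity b y - 1) ^ 2 :=
        Finset.sum_le_sum fun y _ => mul_le_mul_of_nonneg_left
          (klFun_le_sq (div_nonneg (bernDensity_nonneg ha y) (bernDensity_pos hb y).le))
          (bernDensity_pos hb y).le
    _ = (a - b) ^ 2 / (b * (1 - b)) := by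
        have hb₀ : b ≠ 0 := hb.1.ne'
        have hb₁ : 1 - b ≠ 0 := (sub_pos.2 hb.2).ne'
        simp only [Fintype.sum_bool, bernDensity, if_true, Bool.false_eq_true, if_false]
        field_simp
        ring

lemma two_mul_hellingerSq_le_klDiv_bern {a b : ℝ} (ha : a ∈ Set.Icc (0 : ℝ) 1)
    (hb : b ∈ Set.Ioo (0 : ℝ) 1) :
    ENNReal.ofReal (2 * hellingerSq a b) ≤ klDiv (bern a) (bern b) := by
  rw [klDiv_bern ha hb]
  refine ENNReal.ofReal_le_ofReal ?_
  rw [hellingerSq, ← mul_assoc, mul_one_div_cancel two_ne_zero, one_mul]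
  refine Finset.sum_le_sum fun y _ => ?_
  have hby := bernDensity_pos hb y
  calc (√(bernDensity a y) - √(bernDensity b y)) ^ 2
      = bernDensity b y * (√(bernDensity a y / bernDensity b y) - 1) ^ 2 := by
        rw [Real.sqrt_div' _ hby.le, div_sub_one (Real.sqrt_pos.2 hby).ne', div_pow,
          Real.sq_sqrt hby.le, mul_div_cancel₀ _ hby.ne']
    _ ≤ bernDensity b y * klFun (bernDensity a y / bernDensity b y) :=
        mul_le_mul_of_nonneg_left (sq_sqrt_sub_one_le_klFun
          (div_nonneg (bernDensity_nonneg ha y) hby.le)) hby.le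

lemma sq_sub_le_four_mul_sq_sqrt_sub {a b : ℝ} (ha : a ∈ Set.Icc (0 : ℝ) 1)
    (hb : b ∈ Set.Icc (0 : ℝ) 1) : (a - b) ^ 2 ≤ 4 * (√a - √b) ^ 2 := by
  have hfactor : a - b = (√a + √b) * (√a - √b) := by
    rw [← sq_sub_sq, Real.sq_sqrt ha.1, Real.sq_sqrt hb.1]
  have hsum : √a + √b ≤ 2 := by
    linarith [Real.sqrt_le_one.2 ha.2, Real.sqrt_le_one.2 hb.2]
  rw [hfactor, mul_pow]
  exact mul_le_mul_of_nonneg_right (by nlinarith [Real.sqrt_nonneg a, Real.sqrt_nonneg b])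
    (sq_nonneg _)

lemma sq_sub_le_four_mul_hellingerSq {a b : ℝ} (ha : a ∈ Set.Icc (0 : ℝ) 1)
    (hb : b ∈ Set.Icc (0 : ℝ) 1) : (a - b) ^ 2 ≤ 4 * hellingerSq a b := by
  have htrue := sq_sub_le_four_mul_sq_sqrt_sub ha hb
  have hfalse := sq_sub_le_four_mul_sq_sqrt_sub (Set.Icc.mem_iff_one_sub_mem.1 ha)
    (Set.Icc.mem_iff_one_sub_mem.1 hb)
  simp only [hellingerSq, bernDensity, Fintype.sum_bool, if_true, Bool.false_eq_true, if_false]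
  linarith [show (1 - a - (1 - b)) ^ 2 = (a - b) ^ 2 by ring]

lemma hellingerSq_nonneg (a b : ℝ) : 0 ≤ hellingerSq a b :=
  mul_nonneg one_half_pos.le (Finset.sum_nonneg fun _ _ => sq_nonneg _)

lemma continuous_hellingerSq (a : ℝ) : Continuous (hellingerSq a) := by
  unfold hellingerSq bernDensity
  refine continuous_const.mul (continuous_finsetSum _ fun y _ => ?_)
  cases y <;> simp only [if_true, Bool.false_eq_true, if_false] <;> fun_prop

lemma two_mul_hellingerLoss_le_klLoss {f : Covariate → ℝ} (hf : Measurable f)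
    (hmem : ∀ z, f z ∈ Set.Ioo (0 : ℝ) 1) :
    ENNReal.ofReal (2 * hellingerLoss f) ≤ klLoss unif (fun _ => 1 / 2) f := by
  have hmeas : Measurable fun z => 2 * hellingerSq (1 / 2) (f z) :=
    ((continuous_hellingerSq _).measurable.comp hf).const_mul 2
  rw [hellingerLoss, ← integral_const_mul, integral_eq_lintegral_of_nonneg_ae
    (ae_of_all _ fun z => mul_nonneg zero_le_two (hellingerSq_nonneg _ _))
    hmeas.aestronglyMeasurable]
  exact ENNReal.ofReal_toReal_le.trans (lintegral_mono fun z =>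
    two_mul_hellingerSq_le_klDiv_bern (by norm_num) (hmem z))

/-! ### Sums of independent centered variables -/

lemma integral_sq_sum_pi {ι : Type*} [Fintype ι] {Ω : ι → Type*} [∀ i, MeasurableSpace (Ω i)]
    {μ : (i : ι) → Measure (Ω i)} [∀ i, IsProbabilityMeasure (μ i)]
    {X : (i : ι) → Ω i → ℝ} (hX : ∀ i, MemLp (X i) 2 (μ i)) (h₀ : ∀ i, ∫ ω, X i ω ∂(μ i) = 0)
    (s : Finset ι) :
    ∫ ω, (∑ i ∈ s, X i (ω i)) ^ 2 ∂(Measure.pi μ) = ∑ i ∈ s, ∫ ω, X i ω ^ 2 ∂(μ i) := by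
  set Y : ι → ((i : ι) → Ω i) → ℝ := fun i ω => X i (ω i)
  have hY (i : ι) : MemLp (Y i) 2 (Measure.pi μ) :=
    (hX i).comp_measurePreserving (measurePreserving_eval μ i)
  have hY₀ (i : ι) : ∫ ω, Y i ω ∂(Measure.pi μ) = 0 :=
    (integral_comp_eval (hX i).1).trans (h₀ i)
  have hsum₀ : ∫ ω, (∑ i ∈ s, Y i) ω ∂(Measure.pi μ) = 0 := by
    simp only [Finset.sum_apply]
    rw [integral_finsetSum _ fun i _ => (hY i).integrable one_le_two]
    exact Finset.sum_eq_zero fun i _ => hY₀ i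
  have hindep : ProbabilityTheory.iIndepFun Y (Measure.pi μ) :=
    ProbabilityTheory.iIndepFun_pi fun i => (hX i).1.aemeasurable
  have hvar := ProbabilityTheory.IndepFun.variance_sum (s := s) (fun i _ => hY i)
    fun i _ j _ hij => hindep.indepFun hij
  rw [ProbabilityTheory.variance_of_integral_eq_zero
    (memLp_finsetSum' _ fun i _ => hY i).1.aemeasurable hsum₀] at hvar
  simp only [Finset.sum_apply] at hvar
  rw [hvar]
  refine Finset.sum_congr rfl fun i _ => ?_
  rw [ProbabilityTheory.variance_of_integral_eq_zero (hY i).1.aemeasurable (hY₀ i)]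
  exact integral_comp_eval (f := fun z => X i z ^ 2) ((hX i).1.pow 2)

lemma integral_sq_sum_toNat_sub {ι : Type*} [Fintype ι] {p : ι → ℝ}
    (hp : ∀ t, p t ∈ Set.Icc (0 : ℝ) 1) (s : Finset ι) :
    ∫ y, (∑ t ∈ s, ((y t).toNat - p t)) ^ 2 ∂(Measure.pi fun t => bern (p t)) =
      ∑ t ∈ s, p t * (1 - p t) := by
  rw [integral_sq_sum_pi (X := fun t (b : Bool) => (b.toNat : ℝ) - p t)
    (fun _ => MemLp.of_discrete)]
  · refine Finset.sum_congr rfl fun t _ => ?_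
    rw [integral_bern (hp t)]
    simp [bernDensity]
    ring
  · intro t
    rw [integral_bern (hp t)]
    simp [bernDensity]
    ring

/-- The response coded as `1` (for `true`) or `-1`. -/
def sgn (y : Bool) : ℝ := if y then 1 else -1

lemma abs_sgn (y : Bool) : |sgn y| = 1 := by cases y <;> simp [sgn]

lemma sgn_mul_self (y : Bool) : sgn y * sgn y = 1 := by cases y <;> simp [sgn]

lemma sgn_eq_two_mul_toNat_sub (y : Bool) : sgn y = 2 * (y.toNat - 1 / 2) := by
  cases y <;> norm_num [sgn]

lemma integral_sq_sum_sgn {ι : Type*} [Fintype ι] (s : Finset ι) :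
    ∫ y, (∑ t ∈ s, sgn (y t)) ^ 2 ∂(Measure.pi fun _ : ι => bern (1 / 2)) = s.card := by
  simp only [sgn_eq_two_mul_toNat_sub, ← Finset.mul_sum, mul_pow, integral_const_mul]
  rw [integral_sq_sum_toNat_sub (fun _ => by norm_num), Finset.sum_const, nsmul_eq_mul]
  ring

/-! ### The class of conditional densities -/

/-- The midpoint of the covariate space. -/
def origin : Covariate := ⟨0, by norm_num⟩

/-- The excess of `f` over the truth `1 / 2` at the midpoint of the covariate space. -/
def offset (f : Covariate → ℝ) : ℝ := f origin - 1 / 2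

/-- The `γ`-Hölder conditional densities whose offset lies in `[0, 1/32]` and bounds (up to a
factor two) their `γ/2`-Hölder seminorm: oscillation must be paid for by a constant deviation
from `1 / 2`. -/
def offsetClass (γ : ℝ) : Set (Covariate → ℝ) :=
  {f | (∀ z w, |f z - f w| ≤ dist z w ^ γ) ∧
    (∀ z w, |f z - f w| ≤ offset f / 2 * dist z w ^ (γ / 2)) ∧
    offset f ∈ Set.Icc (0 : ℝ) (1 / 32)}

lemma dist_covariate_le_one (z w : Covariate) : dist z w ≤ 1 :=
  (Real.dist_le_of_mem_Icc z.2 w.2).trans (by norm_num)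

section Class

variable {γ : ℝ} {f : Covariate → ℝ}

lemma half_mem_offsetClass (γ : ℝ) : (fun _ => (1 / 2 : ℝ)) ∈ offsetClass γ :=
  ⟨fun z w => by simpa using Real.rpow_nonneg dist_nonneg γ,
    fun z w => by simp [offset], by norm_num [offset]⟩

lemma convex_offsetClass (γ : ℝ) : Convex ℝ (offsetClass γ) := by
  intro f hf g hg a b ha hb hab
  have hdiff (z w : Covariate) : |(a • f + b • g) z - (a • f + b • g) w| ≤
      a * |f z - f w| + b * |g z - g w| := by
    calc |(a • f + b • g) z - (a • f + b • g) w| = |a * (f z - f w) + b * (g z - g w)| := by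
          simp only [Pi.add_apply, Pi.smul_apply, smul_eq_mul]
          ring_nf
      _ ≤ |a * (f z - f w)| + |b * (g z - g w)| := abs_add_le _ _
      _ = a * |f z - f w| + b * |g z - g w| := by
          rw [abs_mul, abs_mul, abs_of_nonneg ha, abs_of_nonneg hb]
  have hoffset : offset (a • f + b • g) = a * offset f + b * offset g := by
    simp only [offset, Pi.add_apply, Pi.smul_apply, smul_eq_mul]
    linear_combination 1 / 2 * hab
  refine ⟨fun z w => (hdiff z w).trans ?_, fun z w => (hdiff z w).trans ?_, ?_⟩
  · calc a * |f z - f w| + b * |g z - g w| ≤ a * dist z w ^ γ + b * dist z w ^ γ := by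
          gcongr
          exacts [hf.1 z w, hg.1 z w]
      _ = dist z w ^ γ := by rw [← add_mul, hab, one_mul]
  · calc a * |f z - f w| + b * |g z - g w|
        ≤ a * (offset f / 2 * dist z w ^ (γ / 2)) + b * (offset g / 2 * dist z w ^ (γ / 2)) := by
          gcongr
          exacts [hf.2.1 z w, hg.2.1 z w]
      _ = offset (a • f + b • g) / 2 * dist z w ^ (γ / 2) := by rw [hoffset]; ring
  · rw [hoffset]
    exact convex_Icc (0 : ℝ) (1 / 32) hf.2.2 hg.2.2 ha hb hab

lemma isClosed_offsetClass (γ : ℝ) : IsClosed (offsetClass γ) := by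
  simp only [offsetClass, offset, Set.ofPred_and, Set.ofPred_forall]
  exact (isClosed_iInter fun z => isClosed_iInter fun w =>
    isClosed_le (by fun_prop) continuous_const).inter
    ((isClosed_iInter fun z => isClosed_iInter fun w =>
      isClosed_le (by fun_prop) (by fun_prop)).inter (isClosed_Icc.preimage (by fun_prop)))

lemma holderWith_of_mem_offsetClass (hγ : 0 < γ) (hf : f ∈ offsetClass γ) :
    HolderWith 1 γ.toNNReal f := by
  intro z w
  rw [edist_dist, edist_dist, Real.coe_toNNReal _ hγ.le, ENNReal.coe_one, one_mul,
    ENNReal.ofReal_rpow_of_nonneg dist_nonneg hγ.le]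
  exact ENNReal.ofReal_le_ofReal (hf.1 z w)

lemma continuous_of_mem_offsetClass (hγ : 0 < γ) (hf : f ∈ offsetClass γ) : Continuous f :=
  (holderWith_of_mem_offsetClass hγ hf).continuous (Real.toNNReal_pos.2 hγ)

lemma abs_sub_half_sub_offset_le (hγ : 0 < γ) (hf : f ∈ offsetClass γ) (z : Covariate) :
    |f z - 1 / 2 - offset f| ≤ offset f / 2 := by
  calc |f z - 1 / 2 - offset f| = |f z - f origin| := by rw [offset]; ring_nf
    _ ≤ offset f / 2 * dist z origin ^ (γ / 2) := hf.2.1 z origin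
    _ ≤ offset f / 2 := mul_le_of_le_one_right (div_nonneg hf.2.2.1 zero_le_two)
        (Real.rpow_le_one dist_nonneg (dist_covariate_le_one _ _) (half_pos hγ).le)

lemma half_offset_le_sub_half (hγ : 0 < γ) (hf : f ∈ offsetClass γ) (z : Covariate) :
    offset f / 2 ≤ f z - 1 / 2 := by
  linarith [(abs_le.1 (abs_sub_half_sub_offset_le hγ hf z)).1]

lemma abs_sub_half_le_two_mul_offset (hγ : 0 < γ) (hf : f ∈ offsetClass γ) (z : Covariate) :
    |f z - 1 / 2| ≤ 2 * offset f := by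
  have h := abs_le.1 (abs_sub_half_sub_offset_le hγ hf z)
  exact abs_le.2 ⟨by linarith [hf.2.2.1], by linarith [hf.2.2.1]⟩

lemma mem_Icc_of_mem_offsetClass (hγ : 0 < γ) (hf : f ∈ offsetClass γ) (z : Covariate) :
    f z ∈ Set.Icc (7 / 16 : ℝ) (9 / 16) := by
  have h := abs_le.1 (abs_sub_half_le_two_mul_offset hγ hf z)
  exact ⟨by linarith [hf.2.2.2], by linarith [hf.2.2.2]⟩

lemma mem_Ioo_of_mem_offsetClass (hγ : 0 < γ) (hf : f ∈ offsetClass γ) (z : Covariate) :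
    f z ∈ Set.Ioo (0 : ℝ) 1 :=
  Set.Icc_subset_Ioo (by norm_num) (by norm_num) (mem_Icc_of_mem_offsetClass hγ hf z)

lemma isCompact_offsetClass (hγ : 0 < γ) : IsCompact (offsetClass γ) :=
  (isCompact_univ_pi fun _ => isCompact_Icc (a := (7 / 16 : ℝ)) (b := 9 / 16)).of_isClosed_subset
    (isClosed_offsetClass γ) fun _ hf z _ => mem_Icc_of_mem_offsetClass hγ hf z

lemma bernDensity_eq_sgn (a : ℝ) (y : Bool) :
    bernDensity a y = 1 / 2 * (1 + 2 * (sgn y * (a - 1 / 2))) := by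
  cases y <;> simp only [bernDensity, sgn, if_true, Bool.false_eq_true, if_false] <;> ring

lemma exists_isMLE_offsetClass (hγ : 0 < γ) {n : ℕ} (x : Fin n → Covariate)
    (y : Fin n → Bool) : ∃ f, IsMLE (offsetClass γ) x y f := by
  have hcont : ContinuousOn (logLik x y) (offsetClass γ) := by
    refine continuousOn_finsetSum _ fun t _ => ContinuousOn.log ?_ fun f hf =>
      (bernDensity_pos (mem_Ioo_of_mem_offsetClass hγ hf _) _).ne'
    simp only [bernDensity_eq_sgn]
    fun_prop
  obtain ⟨f, hf, hmax⟩ :=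
    (isCompact_offsetClass hγ).exists_isMaxOn ⟨_, half_mem_offsetClass γ⟩ hcont
  exact ⟨f, hf, fun g hg => hmax hg⟩

lemma sq_offset_le_hellingerLoss (hγ : 0 < γ) (hf : f ∈ offsetClass γ) :
    offset f ^ 2 / 16 ≤ hellingerLoss f := by
  have hint : Integrable (fun z => hellingerSq (1 / 2) (f z)) unif :=
    Continuous.integrable_of_hasCompactSupport
      ((continuous_hellingerSq _).comp (continuous_of_mem_offsetClass hγ hf))
      (HasCompactSupport.of_compactSpace _)
  have hpoint (z : Covariate) : offset f ^ 2 / 16 ≤ hellingerSq (1 / 2) (f z) := by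
    have hpow := pow_le_pow_left₀ (div_nonneg hf.2.2.1 zero_le_two)
      (half_offset_le_sub_half hγ hf z) 2
    have hhell := sq_sub_le_four_mul_hellingerSq (a := 1 / 2) (b := f z) (by norm_num)
      (Set.Ioo_subset_Icc_self (mem_Ioo_of_mem_offsetClass hγ hf z))
    linarith [sub_sq_comm (1 / 2) (f z), div_pow (offset f) 2 2]
  calc offset f ^ 2 / 16 = ∫ _ : Covariate, offset f ^ 2 / 16 ∂unif := by simp
    _ ≤ hellingerLoss f := integral_mono (integrable_const _) hint hpoint

end Class

/-! ### Bins -/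

/-- The index of the bin `[k / m, (k + 1) / m) - 1 / 2` that contains `z`. The right endpoint of the
covariate space has a bin of its own, so the indices range over `0, …, m`. -/
def bin (m : ℕ) (z : Covariate) : ℕ := ⌊(z.1 + 1 / 2) * m⌋₊

/-- The left endpoint of the `k`-th of the bins of length `1 / m`. -/
def binLeft (m k : ℕ) : Covariate :=
  Set.projIcc (-1 / 2) (1 / 2) (by norm_num) (k / m - 1 / 2)

lemma measurable_bin (m : ℕ) : Measurable (bin m) :=
  Nat.measurable_floor.comp (by fun_prop)

lemma add_half_mem_Icc (z : Covariate) : z.1 + 1 / 2 ∈ Set.Icc (0 : ℝ) 1 :=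
  ⟨by linarith [z.2.1], by linarith [z.2.2]⟩

lemma bin_mem_range (m : ℕ) (z : Covariate) : bin m z ∈ Finset.range (m + 1) :=
  Finset.mem_range_succ_iff.2 <| Nat.floor_le_of_le <|
    mul_le_of_le_one_left m.cast_nonneg (add_half_mem_Icc z).2

lemma bin_two_mul_div_two (m : ℕ) (z : Covariate) : bin (2 * m) z / 2 = bin m z := by
  rw [bin, bin, ← Nat.floor_div_ofNat]
  congr 1
  push_cast
  ring

lemma binLeft_bin_mem_Icc {m : ℕ} (hm : 0 < m) (z : Covariate) :
    (binLeft m (bin m z)).1 ∈ Set.Icc (z.1 - (m : ℝ)⁻¹) z.1 := by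
  have hm' : (0 : ℝ) < m := Nat.cast_pos.2 hm
  have hle : (bin m z : ℝ) / m ≤ z.1 + 1 / 2 :=
    (div_le_iff₀ hm').2 (Nat.floor_le (mul_nonneg (add_half_mem_Icc z).1 hm'.le))
  have hlt : z.1 + 1 / 2 ≤ bin m z / m + (m : ℝ)⁻¹ := by
    rw [← one_div, ← add_div, le_div_iff₀ hm']
    exact (Nat.lt_floor_add_one _).le
  have hmem : (bin m z : ℝ) / m - 1 / 2 ∈ Set.Icc (-1 / 2 : ℝ) (1 / 2) :=
    ⟨by linarith [show (0 : ℝ) ≤ bin m z / m by positivity], by linarith [z.2.2]⟩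
  rw [binLeft, Set.projIcc_of_mem _ hmem]
  constructor <;> dsimp only <;> linarith

lemma dist_binLeft_bin_le {m : ℕ} (hm : 0 < m) (z : Covariate) :
    dist z (binLeft m (bin m z)) ≤ (m : ℝ)⁻¹ := by
  obtain ⟨hlb, hub⟩ := binLeft_bin_mem_Icc hm z
  rw [Subtype.dist_eq, Real.dist_eq, abs_of_nonneg (sub_nonneg.2 hub)]
  linarith

lemma dist_binLeft_bin_two_mul_le {m : ℕ} (hm : 0 < m) (z : Covariate) :
    dist (binLeft (2 * m) (bin (2 * m) z)) (binLeft m (bin m z)) ≤ (m : ℝ)⁻¹ := by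
  obtain ⟨hlb, hub⟩ := binLeft_bin_mem_Icc hm z
  obtain ⟨hlb', hub'⟩ := binLeft_bin_mem_Icc (Nat.mul_pos two_pos hm) z
  have hinv : ((2 * m : ℕ) : ℝ)⁻¹ ≤ (m : ℝ)⁻¹ := by
    gcongr
    lia
  rw [Subtype.dist_eq, Real.dist_eq, abs_le]
  constructor <;> linarith

lemma dist_le_of_bin_eq {m : ℕ} (hm : 0 < m) {z w : Covariate} (h : bin m z = bin m w) :
    dist z w ≤ (m : ℝ)⁻¹ := by
  obtain ⟨hlb, hub⟩ := binLeft_bin_mem_Icc hm z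
  obtain ⟨hlb', hub'⟩ := binLeft_bin_mem_Icc hm w
  rw [h] at hlb hub
  rw [Subtype.dist_eq, Real.dist_eq, abs_le]
  constructor <;> linarith

/-! ### Dyadic chaining -/

section Sample

variable {ι : Type*} [Fintype ι]

/-- The indices of the covariates that fall into the `k`-th of the bins of length `1 / m`. -/
def binSample (m k : ℕ) (x : ι → Covariate) : Finset ι := {t | bin m (x t) = k}

/-- The sum of the absolute values of the sign sums over the bins of length `1 / m`. -/
def absBinSum (m : ℕ) (x : ι → Covariate) (y : ι → Bool) : ℝ :=
  ∑ k ∈ Finset.range (m + 1), |∑ t ∈ binSample m k x, sgn (y t)|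

/-- The sum of the absolute bin sums over the dyadic levels up to `J`, weighted by the bound
`2⁻ʲᵅ` for the oscillation of an `α`-Hölder function on a bin of level `j`. -/
def chainSum (α : ℝ) (J : ℕ) (x : ι → Covariate) (y : ι → Bool) : ℝ :=
  ∑ j ∈ Finset.range (J + 1), ((2 : ℝ) ^ j) ^ (-α) * absBinSum (2 ^ j) x y

lemma sum_range_sum_binSample {M : Type*} [AddCommMonoid M] (m : ℕ) (x : ι → Covariate)
    (φ : ι → M) : ∑ k ∈ Finset.range (m + 1), ∑ t ∈ binSample m k x, φ t = ∑ t, φ t :=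
  Finset.sum_fiberwise_of_maps_to (fun t _ => bin_mem_range m (x t)) φ

lemma abs_sum_sgn_mul_bin_le {m : ℕ} {x : ι → Covariate} (y : ι → Bool) {G : ℕ → ℝ} {B : ℝ}
    (hG : ∀ t, |G (bin m (x t))| ≤ B) :
    |∑ t, sgn (y t) * G (bin m (x t))| ≤ B * absBinSum m x y := by
  rw [← sum_range_sum_binSample m x, absBinSum, Finset.mul_sum]
  refine (Finset.abs_sum_le_sum_abs _ _).trans (Finset.sum_le_sum fun k _ => ?_)
  have hbin (t) (ht : t ∈ binSample m k x) : bin m (x t) = k := (Finset.mem_filter.1 ht).2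
  rw [Finset.sum_congr rfl fun t ht => by rw [hbin t ht], ← Finset.sum_mul, abs_mul, mul_comm]
  obtain hempty | ⟨t, ht⟩ := (binSample m k x).eq_empty_or_nonempty
  · simp [hempty]
  · exact mul_le_mul_of_nonneg_right (hbin t ht ▸ hG t) (abs_nonneg _)

lemma two_pow_rpow_neg_le {α : ℝ} (hα : α ≤ 1) (j : ℕ) :
    ((2 : ℝ) ^ j) ^ (-α) ≤ 2 * ((2 : ℝ) ^ (j + 1)) ^ (-α) := by
  rw [pow_succ, Real.mul_rpow (by positivity) zero_le_two, mul_left_comm]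
  refine le_mul_of_one_le_right (by positivity) ?_
  calc (1 : ℝ) ≤ 2 ^ (1 - α) := Real.one_le_rpow one_le_two (sub_nonneg.2 hα)
    _ = 2 * 2 ^ (-α) := by rw [sub_eq_add_neg, Real.rpow_add two_pos, Real.rpow_one]

lemma rpow_le_two_pow_rpow_neg {α d : ℝ} (hα : 0 ≤ α) (hd : 0 ≤ d) {j : ℕ}
    (hdj : d ≤ ((2 ^ j : ℕ) : ℝ)⁻¹) : d ^ α ≤ ((2 : ℝ) ^ j) ^ (-α) := by
  rw [Real.rpow_neg (by positivity), ← Real.inv_rpow (by positivity)]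
  exact Real.rpow_le_rpow hd (by exact_mod_cast hdj) hα

lemma abs_sum_sgn_mul_binLeft_le {α β : ℝ} (hα₀ : 0 ≤ α) (hα₁ : α ≤ 1) {g : Covariate → ℝ}
    (hbound : ∀ z, |g z| ≤ β) (hholder : ∀ z w, |g z - g w| ≤ β / 2 * dist z w ^ α)
    (J : ℕ) (x : ι → Covariate) (y : ι → Bool) :
    |∑ t, sgn (y t) * g (binLeft (2 ^ J) (bin (2 ^ J) (x t)))| ≤ β * chainSum α J x y := by
  induction J with
  | zero =>
    have hcoarse := abs_sum_sgn_mul_bin_le (m := 1) (x := x) y (G := fun k => g (binLeft 1 k))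
      fun t => hbound _
    simpa [chainSum] using hcoarse
  | succ J ih =>
    have hβ : 0 ≤ β := (abs_nonneg _).trans (hbound origin)
    have hhalf (t : ι) : bin (2 ^ (J + 1)) (x t) / 2 = bin (2 ^ J) (x t) := by
      rw [pow_succ', bin_two_mul_div_two]
    have hincr (t : ι) : |g (binLeft (2 ^ (J + 1)) (bin (2 ^ (J + 1)) (x t))) -
        g (binLeft (2 ^ J) (bin (2 ^ J) (x t)))| ≤ β * ((2 : ℝ) ^ (J + 1)) ^ (-α) := by
      have hdist := dist_binLeft_bin_two_mul_le (m := 2 ^ J) (by positivity) (x t)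
      rw [← pow_succ'] at hdist
      calc _ ≤ β / 2 * ((2 : ℝ) ^ J) ^ (-α) := (hholder _ _).trans <|
            mul_le_mul_of_nonneg_left (rpow_le_two_pow_rpow_neg hα₀ dist_nonneg hdist) (by linarith)
        _ ≤ β / 2 * (2 * ((2 : ℝ) ^ (J + 1)) ^ (-α)) :=
            mul_le_mul_of_nonneg_left (two_pow_rpow_neg_le hα₁ J) (by linarith)
        _ = β * ((2 : ℝ) ^ (J + 1)) ^ (-α) := by ring
    have hfine := abs_sum_sgn_mul_bin_le (m := 2 ^ (J + 1)) (x := x) y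
      (G := fun k => g (binLeft (2 ^ (J + 1)) k) - g (binLeft (2 ^ J) (k / 2)))
      fun t => by simpa only [hhalf] using hincr t
    simp only [hhalf] at hfine
    calc _ = |∑ t, sgn (y t) * g (binLeft (2 ^ J) (bin (2 ^ J) (x t))) +
          ∑ t, sgn (y t) * (g (binLeft (2 ^ (J + 1)) (bin (2 ^ (J + 1)) (x t))) -
            g (binLeft (2 ^ J) (bin (2 ^ J) (x t))))| := by
          simp only [← Finset.sum_add_distrib, ← mul_add, add_sub_cancel]
      _ ≤ β * chainSum α J x y + β * ((2 : ℝ) ^ (J + 1)) ^ (-α) * absBinSum (2 ^ (J + 1)) x y :=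
          (abs_add_le _ _).trans (add_le_add ih hfine)
      _ = β * chainSum α (J + 1) x y := by
          rw [chainSum, chainSum, Finset.sum_range_succ _ (J + 1)]
          ring

lemma sum_sgn_mul_le_chainSum {α γ β : ℝ} (hα₀ : 0 ≤ α) (hα₁ : α ≤ 1) (hγ : 0 ≤ γ)
    {g : Covariate → ℝ} (hbound : ∀ z, |g z| ≤ β)
    (hholder : ∀ z w, |g z - g w| ≤ β / 2 * dist z w ^ α)
    (hmesh : ∀ z w, |g z - g w| ≤ dist z w ^ γ) (J : ℕ) (x : ι → Covariate) (y : ι → Bool) :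
    ∑ t, sgn (y t) * g (x t) ≤
      β * chainSum α J x y + Fintype.card ι * ((2 : ℝ) ^ J) ^ (-γ) := by
  have hchain := abs_sum_sgn_mul_binLeft_le hα₀ hα₁ hbound hholder J x y
  have hrem (t : ι) : sgn (y t) * (g (x t) - g (binLeft (2 ^ J) (bin (2 ^ J) (x t)))) ≤
      ((2 : ℝ) ^ J) ^ (-γ) := by
    refine (le_abs_self _).trans ?_
    rw [abs_mul, abs_sgn, one_mul]
    exact (hmesh _ _).trans <| rpow_le_two_pow_rpow_neg hγ dist_nonneg <|
      dist_binLeft_bin_le (by positivity) (x t)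
  calc ∑ t, sgn (y t) * g (x t)
      = ∑ t, sgn (y t) * g (binLeft (2 ^ J) (bin (2 ^ J) (x t))) +
        ∑ t, sgn (y t) * (g (x t) - g (binLeft (2 ^ J) (bin (2 ^ J) (x t)))) := by
        simp only [← Finset.sum_add_distrib, ← mul_add, add_sub_cancel]
    _ ≤ β * chainSum α J x y + ∑ _t : ι, ((2 : ℝ) ^ J) ^ (-γ) :=
        add_le_add ((le_abs_self _).trans hchain) (Finset.sum_le_sum fun t _ => hrem t)
    _ = β * chainSum α J x y + Fintype.card ι * ((2 : ℝ) ^ J) ^ (-γ) := by simp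

/-! ### The first moment of the chain sum -/

lemma sq_absBinSum_le (m : ℕ) (x : ι → Covariate) (y : ι → Bool) :
    absBinSum m x y ^ 2 ≤
      (m + 1) * ∑ k ∈ Finset.range (m + 1), (∑ t ∈ binSample m k x, sgn (y t)) ^ 2 := by
  have hcs := sq_sum_le_card_mul_sum_sq (s := Finset.range (m + 1))
    (f := fun k => |∑ t ∈ binSample m k x, sgn (y t)|)
  simpa only [absBinSum, sq_abs, Finset.card_range, Nat.cast_add, Nat.cast_one] using hcs

lemma integral_absBinSum_le (m : ℕ) (x : ι → Covariate) :
    ∫ y, absBinSum m x y ∂(Measure.pi fun _ => bern (1 / 2)) ≤ √((m + 1) * Fintype.card ι) := by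
  set ν : Measure (ι → Bool) := Measure.pi fun _ => bern (1 / 2)
  have hvar := ProbabilityTheory.variance_nonneg (absBinSum m x) ν
  rw [ProbabilityTheory.variance_eq_sub MemLp.of_discrete] at hvar
  refine Real.le_sqrt_of_sq_le ((sub_nonneg.1 hvar).trans ?_)
  calc ∫ y, absBinSum m x y ^ 2 ∂ν
      ≤ ∫ y, (m + 1) * ∑ k ∈ Finset.range (m + 1), (∑ t ∈ binSample m k x, sgn (y t)) ^ 2 ∂ν :=
        integral_mono .of_finite .of_finite (sq_absBinSum_le m x)
    _ = (m + 1) * ∑ k ∈ Finset.range (m + 1), ((binSample m k x).card : ℝ) := by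
        rw [integral_const_mul, integral_finsetSum _ fun k _ => .of_finite]
        simp only [ν, integral_sq_sum_sgn]
    _ = (m + 1) * Fintype.card ι := by
        simp only [Finset.cast_card]
        rw [sum_range_sum_binSample m x fun _ => (1 : ℝ), ← Finset.cast_card, Finset.card_univ]

/-- The constant in the bound for the expected chain sum, from summing the geometric series with
ratio `2 ^ (1 / 2 - α)`. -/
def chainConst (α : ℝ) : ℝ := √2 * ((2 : ℝ) ^ (1 / 2 - α) / ((2 : ℝ) ^ (1 / 2 - α) - 1))

lemma one_lt_two_rpow {α : ℝ} (hα : α < 1 / 2) : 1 < (2 : ℝ) ^ (1 / 2 - α) :=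
  Real.one_lt_rpow one_lt_two (sub_pos.2 hα)

lemma chainConst_pos {α : ℝ} (hα : α < 1 / 2) : 0 < chainConst α :=
  mul_pos (by positivity) (div_pos (by positivity) (sub_pos.2 (one_lt_two_rpow hα)))

lemma weighted_integral_absBinSum_le (α : ℝ) (j : ℕ) (x : ι → Covariate) :
    ((2 : ℝ) ^ j) ^ (-α) * ∫ y, absBinSum (2 ^ j) x y ∂(Measure.pi fun _ => bern (1 / 2)) ≤
      √2 * √(Fintype.card ι) * ((2 : ℝ) ^ (1 / 2 - α)) ^ j := by
  have hpow : ((2 : ℝ) ^ (1 / 2 - α)) ^ j = ((2 : ℝ) ^ j) ^ (-α) * √((2 : ℝ) ^ j) := by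
    rw [Real.sqrt_eq_rpow, ← Real.rpow_add (by positivity), Real.rpow_pow_comm zero_le_two]
    ring_nf
  have hone : (1 : ℝ) ≤ 2 ^ j := one_le_pow₀ one_le_two
  calc ((2 : ℝ) ^ j) ^ (-α) * ∫ y, absBinSum (2 ^ j) x y ∂(Measure.pi fun _ => bern (1 / 2))
      ≤ ((2 : ℝ) ^ j) ^ (-α) * √(2 * Fintype.card ι * 2 ^ j) := by
        refine mul_le_mul_of_nonneg_left ((integral_absBinSum_le _ x).trans ?_) (by positivity)
        refine Real.sqrt_le_sqrt ?_
        push_cast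
        nlinarith [(Nat.cast_nonneg (Fintype.card ι) : (0 : ℝ) ≤ _)]
    _ = √2 * √(Fintype.card ι) * ((2 : ℝ) ^ (1 / 2 - α)) ^ j := by
        rw [hpow, Real.sqrt_mul (by positivity), Real.sqrt_mul zero_le_two]
        ring

lemma integral_chainSum_le {α : ℝ} (hα : α < 1 / 2) (J : ℕ) (x : ι → Covariate) :
    ∫ y, chainSum α J x y ∂(Measure.pi fun _ => bern (1 / 2)) ≤
      chainConst α * √(Fintype.card ι) * ((2 : ℝ) ^ J) ^ (1 / 2 - α) := by
  set r : ℝ := (2 : ℝ) ^ (1 / 2 - α) with hr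
  have hr₁ : 0 < r - 1 := sub_pos.2 (one_lt_two_rpow hα)
  have hgeom : ∑ j ∈ Finset.range (J + 1), r ^ j ≤ r / (r - 1) * r ^ J := by
    rw [geom_sum_eq (sub_pos.1 hr₁).ne', div_mul_eq_mul_div, ← pow_succ']
    gcongr
    linarith
  calc ∫ y, chainSum α J x y ∂(Measure.pi fun _ => bern (1 / 2))
      = ∑ j ∈ Finset.range (J + 1), ((2 : ℝ) ^ j) ^ (-α) *
          ∫ y, absBinSum (2 ^ j) x y ∂(Measure.pi fun _ => bern (1 / 2)) := by
        simp only [chainSum]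
        rw [integral_finsetSum _ fun _ _ => .of_finite]
        simp only [integral_const_mul]
    _ ≤ ∑ j ∈ Finset.range (J + 1), √2 * √(Fintype.card ι) * r ^ j :=
        Finset.sum_le_sum fun j _ => weighted_integral_absBinSum_le α j x
    _ ≤ √2 * √(Fintype.card ι) * (r / (r - 1) * r ^ J) := by
        rw [← Finset.mul_sum]
        exact mul_le_mul_of_nonneg_left hgeom (by positivity)
    _ = chainConst α * √(Fintype.card ι) * ((2 : ℝ) ^ J) ^ (1 / 2 - α) := by
        rw [chainConst, ← hr, ← Real.rpow_pow_comm zero_le_two]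
        ring

end Sample

/-! ### Isolated sample points -/

open scoped Classical in
/-- The indices whose sample point has distance at least `r` from all the others. -/
def isolated {X ι : Type*} [PseudoMetricSpace X] [Fintype ι] (r : ℝ) (x : ι → X) : Finset ι :=
  {t | ∀ s, s ≠ t → r ≤ dist (x s) (x t)}

section Isolated

variable {X ι : Type*} [PseudoMetricSpace X] [Fintype ι] {r : ℝ} {x : ι → X} {s t : ι}

lemma mem_isolated : t ∈ isolated r x ↔ ∀ s, s ≠ t → r ≤ dist (x s) (x t) := by
  simp [isolated]

lemma notMem_isolated : t ∉ isolated r x ↔ ∃ s, s ≠ t ∧ dist (x s) (x t) < r := by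
  simp [mem_isolated]

lemma le_dist_of_mem_isolated (ht : t ∈ isolated r x) (hst : s ≠ t) : r ≤ dist (x s) (x t) :=
  mem_isolated.1 ht s hst

lemma card_compl_isolated [DecidableEq ι] (r : ℝ) (x : ι → X) :
    ((isolated r x)ᶜ.card : ℝ≥0∞) = ∑ t, {x | t ∉ isolated r x}.indicator 1 x := by
  simp [Set.indicator_apply, ← Finset.compl_filter, Finset.sum_ite]

variable [MeasurableSpace X] [OpensMeasurableSpace X] [SecondCountableTopology X]

lemma measurableSet_notMem_isolated (r : ℝ) (t : ι) :
    MeasurableSet {x : ι → X | t ∉ isolated r x} := by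
  simp only [notMem_isolated, Set.ofPred_exists, Set.ofPred_and]
  exact .iUnion fun s => (MeasurableSet.const _).inter
    (measurableSet_lt (by fun_prop) measurable_const)

lemma measurable_card_compl_isolated [DecidableEq ι] (r : ℝ) :
    Measurable fun x : ι → X => ((isolated r x)ᶜ.card : ℝ≥0∞) := by
  simp only [card_compl_isolated]
  exact Finset.measurable_sum _ fun t _ =>
    measurable_one.indicator (measurableSet_notMem_isolated r t)

variable {μ : Measure X} [IsProbabilityMeasure μ] {b : ℝ≥0∞}

lemma measure_pi_dist_lt_le (hb : ∀ z, μ (Metric.ball z r) ≤ b) (hst : s ≠ t) :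
    (Measure.pi fun _ : ι => μ) {x | dist (x s) (x t) < r} ≤ b := by
  have hindep : ProbabilityTheory.IndepFun (fun x : ι → X => x s) (fun x => x t)
      (Measure.pi fun _ => μ) :=
    (ProbabilityTheory.iIndepFun_pi (X := fun _ => id) fun _ => aemeasurable_id).indepFun hst
  have hpair : (Measure.pi fun _ : ι => μ).map (fun x => (x s, x t)) = μ.prod μ := by
    rw [(ProbabilityTheory.indepFun_iff_map_prod_eq_prod_map_map
      (measurable_pi_apply s).aemeasurable (measurable_pi_apply t).aemeasurable).1 hindep,
      (measurePreserving_eval (fun _ : ι => μ) s).map_eq,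
      (measurePreserving_eval (fun _ : ι => μ) t).map_eq]
  have hclose : MeasurableSet {p : X × X | dist p.1 p.2 < r} :=
    measurableSet_lt measurable_dist measurable_const
  calc (Measure.pi fun _ : ι => μ) {x | dist (x s) (x t) < r}
      = μ.prod μ {p | dist p.1 p.2 < r} := by
        rw [← hpair, Measure.map_apply (by fun_prop) hclose]
        rfl
    _ = ∫⁻ z, μ {w | dist z w < r} ∂μ := Measure.prod_apply hclose
    _ ≤ ∫⁻ _, b ∂μ := lintegral_mono fun z => by
        simpa only [Metric.ball, dist_comm] using hb z
    _ = b := by simp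

lemma lintegral_card_compl_isolated_le [DecidableEq ι] (hb : ∀ z, μ (Metric.ball z r) ≤ b) :
    ∫⁻ x, ((isolated r x)ᶜ.card : ℝ≥0∞) ∂(Measure.pi fun _ : ι => μ) ≤ Fintype.card ι ^ 2 * b := by
  set P : Measure (ι → X) := Measure.pi fun _ => μ
  have hnot (t : ι) : P {x | t ∉ isolated r x} ≤ Fintype.card ι * b := by
    calc P {x | t ∉ isolated r x} ≤ P (⋃ s ∈ Finset.univ.erase t, {x | dist (x s) (x t) < r}) :=
          measure_mono fun x hx => by simpa [notMem_isolated] using hx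
      _ ≤ ∑ _s ∈ Finset.univ.erase t, b := (measure_biUnion_finset_le _ _).trans <|
          Finset.sum_le_sum fun _ hs => measure_pi_dist_lt_le hb (Finset.ne_of_mem_erase hs)
      _ ≤ ∑ _s : ι, b := Finset.sum_le_sum_of_subset (Finset.erase_subset _ _)
      _ = Fintype.card ι * b := by simp
  calc ∫⁻ x, ((isolated r x)ᶜ.card : ℝ≥0∞) ∂P = ∑ t, P {x | t ∉ isolated r x} := by
        simp only [card_compl_isolated]
        rw [lintegral_finsetSum _ fun t _ =>
          measurable_one.indicator (measurableSet_notMem_isolated r t)]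
        simp only [lintegral_indicator_one (measurableSet_notMem_isolated r _)]
    _ ≤ ∑ _t : ι, Fintype.card ι * b := Finset.sum_le_sum fun t _ => hnot t
    _ = Fintype.card ι ^ 2 * b := by simp [sq, mul_assoc]

end Isolated

lemma unif_ball_le (z : Covariate) (r : ℝ) : unif (Metric.ball z r) ≤ ENNReal.ofReal (2 * r) := by
  rw [unif, comap_subtype_coe_apply measurableSet_Icc, ← Real.volume_ball z.1 r]
  exact measure_mono (Set.image_subset_iff.2 fun w hw => hw)

/-! ### Spikes at the isolated sample points -/

lemma exists_lipschitzWith_interpolant {X ι : Type*} [PseudoMetricSpace X] {x : ι → X}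
    {v : ι → ℝ} {K : NNReal} (hv : ∀ t, |v t| ≤ 1)
    (hlip : ∀ s t, |v s - v t| ≤ K * dist (x s) (x t)) :
    ∃ g : X → ℝ, LipschitzWith K g ∧ (∀ z, |g z| ≤ 1) ∧ ∀ t, g (x t) = v t := by
  have hfactors : Function.FactorsThrough v x := fun s t hst => by
    simpa [hst, sub_eq_zero] using hlip s t
  have hon : LipschitzOnWith K (Function.extend x v 0) (Set.range x) := by
    refine LipschitzOnWith.of_dist_le_mul ?_
    rintro _ ⟨s, rfl⟩ _ ⟨t, rfl⟩
    rw [hfactors.extend_apply, hfactors.extend_apply, Real.dist_eq]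
    exact hlip s t
  obtain ⟨g, hg, heq⟩ := hon.extend_real
  refine ⟨fun z => max (-1) (min 1 (g z)), (hg.const_min 1).const_max (-1), fun z => ?_,
    fun t => ?_⟩
  · exact abs_le.2 ⟨le_max_left _ _, max_le (by norm_num) (min_le_left _ _)⟩
  · change max (-1) (min 1 (g (x t))) = v t
    rw [← heq (Set.mem_range_self t), hfactors.extend_apply, min_eq_right (abs_le.1 (hv t)).2,
      max_eq_right (abs_le.1 (hv t)).1]

lemma exists_spikes {X ι : Type*} [PseudoMetricSpace X] [Fintype ι] {ρ : ℝ} (hρ : 0 < ρ)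
    (x : ι → X) {h : ι → ℝ} (hh : ∀ t, |h t| ≤ 1) :
    ∃ g : X → ℝ, (∀ z w, |g z - g w| ≤ dist z w / ρ) ∧ (∀ z, |g z| ≤ 1) ∧
      ∀ t, g (x t) = (isolated (2 * ρ) x : Set ι).indicator h t := by
  set v : ι → ℝ := (isolated (2 * ρ) x : Set ι).indicator h
  have hv (t : ι) : |v t| ≤ 1 := by
    simpa only [Real.norm_eq_abs] using (norm_indicator_le_norm_self h t).trans (hh t)
  have hfar (s t : ι) (hst : 2 * ρ ≤ dist (x s) (x t)) :
      |v s - v t| ≤ ρ⁻¹ * dist (x s) (x t) := by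
    rw [inv_mul_eq_div, le_div_iff₀ hρ]
    nlinarith [abs_sub (v s) (v t), hv s, hv t]
  have hlip (s t : ι) : |v s - v t| ≤ ρ⁻¹ * dist (x s) (x t) := by
    by_cases hst : s = t
    · simp [hst]
    by_cases hs : s ∈ isolated (2 * ρ) x
    · exact hfar s t (dist_comm (x s) (x t) ▸ le_dist_of_mem_isolated hs (Ne.symm hst))
    by_cases ht : t ∈ isolated (2 * ρ) x
    · exact hfar s t (le_dist_of_mem_isolated ht hst)
    · simp only [v, Set.indicator_of_notMem (Finset.mem_coe.not.2 hs),
        Set.indicator_of_notMem (Finset.mem_coe.not.2 ht), sub_self, abs_zero]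
      positivity
  obtain ⟨g, hg, hg₁, hgx⟩ :=
    exists_lipschitzWith_interpolant (K := ⟨ρ⁻¹, (inv_pos.2 hρ).le⟩) hv hlip
  refine ⟨g, fun z w => ?_, hg₁, hgx⟩
  rw [div_eq_inv_mul, ← Real.dist_eq]
  exact hg.dist_le_mul z w

lemma le_two_mul_rpow_of_le {d u α : ℝ} (hu : 0 ≤ u) (hα₀ : 0 ≤ α) (hα₁ : α ≤ 1) (hd₂ : d ≤ 2)
    (hdu : d ≤ u) : d ≤ 2 * u ^ α := by
  rcases le_total u 1 with hu₁ | hu₁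
  · have := Real.rpow_le_rpow_of_exponent_ge' hu hu₁ hα₀ hα₁
    rw [Real.rpow_one] at this
    linarith
  · linarith [Real.one_le_rpow hu₁ hα₀]

/-! ### The likelihood gain of the class -/

lemma sub_two_mul_sq_le_log_one_add {v : ℝ} (hv : -(1 / 2) ≤ v) :
    v - 2 * v ^ 2 ≤ Real.log (1 + v) := by
  have hpos : 0 < 1 + v := by linarith
  calc v - 2 * v ^ 2 ≤ 1 - (1 + v)⁻¹ := by
        rw [le_sub_comm, inv_le_iff_one_le_mul₀ hpos]
        nlinarith [mul_nonneg (sq_nonneg v) (by linarith : 0 ≤ 1 + 2 * v)]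
    _ ≤ Real.log (1 + v) := Real.one_sub_inv_le_log_of_pos hpos

section Likelihood

variable {n : ℕ} (x : Fin n → Covariate) (y : Fin n → Bool) {f : Covariate → ℝ}

lemma logLik_sub_logLik_half (hf : ∀ z, f z ∈ Set.Ioo (0 : ℝ) 1) :
    logLik x y f - logLik x y (fun _ => 1 / 2) =
      ∑ t, Real.log (1 + 2 * (sgn (y t) * (f (x t) - 1 / 2))) := by
  rw [logLik, logLik, ← Finset.sum_sub_distrib]
  refine Finset.sum_congr rfl fun t _ => ?_
  rw [← Real.log_div (bernDensity_pos (hf _) _).ne' (bernDensity_pos (by norm_num) _).ne',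
    bernDensity_eq_sgn, bernDensity_eq_sgn (1 / 2)]
  congr 1
  ring

lemma logLik_sub_logLik_half_le (hf : ∀ z, f z ∈ Set.Ioo (0 : ℝ) 1) :
    logLik x y f - logLik x y (fun _ => 1 / 2) ≤ 2 * ∑ t, sgn (y t) * (f (x t) - 1 / 2) := by
  rw [logLik_sub_logLik_half x y hf, Finset.mul_sum]
  refine Finset.sum_le_sum fun t _ => ?_
  have hpos := bernDensity_pos (hf (x t)) (y t)
  rw [bernDensity_eq_sgn] at hpos
  linarith [Real.log_le_sub_one_of_pos (pos_of_mul_pos_right hpos (by norm_num))]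

lemma le_logLik_sub_logLik_half {b : ℝ} (hb : b ≤ 1 / 4) (hf : ∀ z, |f z - 1 / 2| ≤ b) :
    2 * ∑ t, sgn (y t) * (f (x t) - 1 / 2) - 8 * n * b ^ 2 ≤
      logLik x y f - logLik x y (fun _ => 1 / 2) := by
  have habs (t : Fin n) : |sgn (y t) * (f (x t) - 1 / 2)| ≤ b := by
    rw [abs_mul, abs_sgn, one_mul]
    exact hf _
  have hmem (z : Covariate) : f z ∈ Set.Ioo (0 : ℝ) 1 := by
    have h := abs_le.1 (hf z)
    exact ⟨by linarith, by linarith⟩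
  rw [logLik_sub_logLik_half x y hmem, Finset.mul_sum]
  calc ∑ t, 2 * (sgn (y t) * (f (x t) - 1 / 2)) - 8 * n * b ^ 2
      = ∑ t, (2 * (sgn (y t) * (f (x t) - 1 / 2)) - 8 * b ^ 2) := by
        rw [Finset.sum_sub_distrib, Finset.sum_const, Finset.card_univ, Fintype.card_fin,
          nsmul_eq_mul]
        ring
    _ ≤ ∑ t, Real.log (1 + 2 * (sgn (y t) * (f (x t) - 1 / 2))) :=
        Finset.sum_le_sum fun t _ => by
          have hsq := sq_le_sq' (abs_le.1 (habs t)).1 (abs_le.1 (habs t)).2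
          have hlow : -(1 / 2) ≤ 2 * (sgn (y t) * (f (x t) - 1 / 2)) := by
            linarith [(abs_le.1 (habs t)).1]
          linarith [sub_two_mul_sq_le_log_one_add hlow]

end Likelihood

lemma rpow_mul_abs_sub_le {X : Type*} [PseudoMetricSpace X] {ρ α : ℝ} (hρ : 0 < ρ)
    (hα : α ∈ Set.Icc (0 : ℝ) 1) {g : X → ℝ} (hlip : ∀ z w, |g z - g w| ≤ dist z w / ρ)
    (hg : ∀ z, |g z| ≤ 1) (z w : X) : ρ ^ α * |g z - g w| ≤ 2 * dist z w ^ α := by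
  have htwo : |g z - g w| ≤ 2 := by linarith [abs_sub (g z) (g w), hg z, hg w]
  calc ρ ^ α * |g z - g w| ≤ ρ ^ α * (2 * (dist z w / ρ) ^ α) := by
        gcongr
        exact le_two_mul_rpow_of_le (by positivity) hα.1 hα.2 htwo (hlip z w)
    _ = 2 * dist z w ^ α := by
        rw [Real.div_rpow dist_nonneg hρ.le]
        field_simp

lemma exists_mem_offsetClass_spikes {ι : Type*} [Fintype ι] {γ ρ : ℝ}
    (hγ : γ ∈ Set.Icc (0 : ℝ) 1) (hρ₀ : 0 < ρ) (hρ₁ : ρ ≤ 1) (x : ι → Covariate) {h : ι → ℝ}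
    (hh : ∀ t, |h t| ≤ 1) :
    ∃ f ∈ offsetClass γ, (∀ z, |f z - 1 / 2| ≤ ρ ^ (γ / 2) / 64) ∧
      ∀ t, f (x t) - 1 / 2 = 7 / 512 * ρ ^ (γ / 2) +
        1 / 512 * ρ ^ γ * (isolated (2 * ρ) x : Set ι).indicator h t := by
  obtain ⟨g, hlip, hg, hgx⟩ := exists_spikes hρ₀ x hh
  have hholder {α : ℝ} (hα : α ∈ Set.Icc (0 : ℝ) 1) (z w : Covariate) :=
    rpow_mul_abs_sub_le hρ₀ hα hlip hg z w
  set q : ℝ := ρ ^ (γ / 2) with hq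
  set p : ℝ := ρ ^ γ
  have hq₀ : 0 ≤ q := Real.rpow_nonneg hρ₀.le _
  have hp₀ : 0 ≤ p := Real.rpow_nonneg hρ₀.le _
  have hpq : p = q * q := by rw [hq, ← Real.rpow_add hρ₀, add_halves]
  have hq₁ : q ≤ 1 := Real.rpow_le_one hρ₀.le hρ₁ (by linarith [hγ.1])
  have hpg (z : Covariate) : |p * g z| ≤ q := by
    rw [abs_mul, abs_of_nonneg hp₀, hpq]
    exact (mul_le_of_le_one_right (mul_nonneg hq₀ hq₀) (hg z)).trans
      (mul_le_of_le_one_left hq₀ hq₁)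
  have hdiff (z w : Covariate) : |1 / 2 + 7 / 512 * q + 1 / 512 * p * g z -
      (1 / 2 + 7 / 512 * q + 1 / 512 * p * g w)| = 1 / 512 * p * |g z - g w| := by
    rw [add_sub_add_left_eq_sub, ← mul_sub, abs_mul, abs_of_nonneg (by positivity)]
  have horigin := abs_le.1 (hpg origin)
  have hoffset : offset (fun z => 1 / 2 + 7 / 512 * q + 1 / 512 * p * g z) =
      7 / 512 * q + 1 / 512 * (p * g origin) := by
    rw [offset]
    ring
  refine ⟨_, ⟨fun z w => (hdiff z w).trans_le ?_, fun z w => (hdiff z w).trans_le ?_, ?_⟩,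
    fun z => ?_, fun t => ?_⟩
  · linarith [hholder hγ z w, Real.rpow_nonneg (dist_nonneg (x := z) (y := w)) γ]
  · have hhalf := hholder (α := γ / 2) ⟨by linarith [hγ.1], by linarith [hγ.2]⟩ z w
    calc 1 / 512 * p * |g z - g w| = 1 / 512 * q * (q * |g z - g w|) := by rw [hpq]; ring
      _ ≤ 1 / 512 * q * (2 * dist z w ^ (γ / 2)) := by gcongr
      _ = 2 / 512 * q * dist z w ^ (γ / 2) := by ring
      _ ≤ offset (fun z => 1 / 2 + 7 / 512 * q + 1 / 512 * p * g z) / 2 *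
          dist z w ^ (γ / 2) := by
        gcongr
        linarith [horigin.1]
  · rw [hoffset]
    exact ⟨by linarith [horigin.1], by linarith [horigin.2]⟩
  · have h := abs_le.1 (hpg z)
    exact abs_le.2 ⟨by linarith [h.1], by linarith [h.2]⟩
  · rw [← hgx]
    ring

lemma sum_mul_indicator_sgn {ι : Type*} [Fintype ι] (y : ι → Bool) (s : Finset ι) :
    ∑ t, sgn (y t) * (s : Set ι).indicator (fun t => sgn (y t)) t = s.card := by
  classical
  simp [Set.indicator_apply, mul_ite, sgn_mul_self]

lemma exists_mem_offsetClass_le_logLik_sub {γ ρ : ℝ} (hγ : γ ∈ Set.Icc (0 : ℝ) 1) (hρ₀ : 0 < ρ)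
    (hρ₁ : ρ ≤ 1) {n : ℕ} {x : Fin n → Covariate} (y : Fin n → Bool)
    (hiso : 3 / 4 * (n : ℝ) ≤ (isolated (2 * ρ) x).card) :
    ∃ f ∈ offsetClass γ, n * ρ ^ γ / 1024 - 7 / 256 * ρ ^ (γ / 2) * |∑ t, sgn (y t)| ≤
      logLik x y f - logLik x y (fun _ => 1 / 2) := by
  obtain ⟨f, hf, hfb, hfx⟩ := exists_mem_offsetClass_spikes hγ hρ₀ hρ₁ x
    (h := fun t => sgn (y t)) fun t => (abs_sgn _).le
  refine ⟨f, hf, le_trans ?_ (le_logLik_sub_logLik_half x y ?_ hfb)⟩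
  · have hsum : ∑ t, sgn (y t) * (f (x t) - 1 / 2) =
        7 / 512 * ρ ^ (γ / 2) * ∑ t, sgn (y t) + 1 / 512 * ρ ^ γ * (isolated (2 * ρ) x).card := by
      rw [← sum_mul_indicator_sgn y, Finset.mul_sum, Finset.mul_sum, ← Finset.sum_add_distrib]
      refine Finset.sum_congr rfl fun t _ => ?_
      rw [hfx]
      ring
    have hpq : ρ ^ γ = (ρ ^ (γ / 2)) ^ 2 := by
      rw [sq, ← Real.rpow_add hρ₀, add_halves]
    have hsign := mul_le_mul_of_nonneg_left (neg_abs_le (∑ t, sgn (y t)))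
      (Real.rpow_nonneg hρ₀.le (γ / 2))
    have hcard := mul_le_mul_of_nonneg_left hiso (Real.rpow_nonneg hρ₀.le γ)
    rw [hsum, div_pow, ← hpq]
    linarith
  · linarith [Real.rpow_le_one hρ₀.le hρ₁ (by linarith [hγ.1] : 0 ≤ γ / 2)]

lemma logLik_sub_logLik_half_le_chainSum {γ : ℝ} (hγ : γ ∈ Set.Ioc (0 : ℝ) 2) {n : ℕ}
    (x : Fin n → Covariate) (y : Fin n → Bool) {f : Covariate → ℝ} (hf : f ∈ offsetClass γ)
    (J : ℕ) :
    logLik x y f - logLik x y (fun _ => 1 / 2) ≤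
      4 * offset f * chainSum (γ / 2) J x y + 2 * (n * ((2 : ℝ) ^ J) ^ (-γ)) := by
  have hchain := sum_sgn_mul_le_chainSum (α := γ / 2) (β := 2 * offset f)
    (g := fun z => f z - 1 / 2) (by linarith [hγ.1]) (by linarith [hγ.2]) hγ.1.le
    (abs_sub_half_le_two_mul_offset hγ.1 hf)
    (fun z w => by
      rw [sub_sub_sub_cancel_right]
      refine (hf.2.1 z w).trans ?_
      gcongr
      linarith [hf.2.2.1])
    (fun z w => by simpa only [sub_sub_sub_cancel_right] using hf.1 z w) J x y
  rw [Fintype.card_fin] at hchain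
  linarith [logLik_sub_logLik_half_le x y (mem_Ioo_of_mem_offsetClass hγ.1 hf)]

lemma IsMLE.le_offset_mul_chainSum {γ ρ : ℝ} (hγ : γ ∈ Set.Ioc (0 : ℝ) 1) (hρ₀ : 0 < ρ)
    (hρ₁ : ρ ≤ 1) {n : ℕ} {x : Fin n → Covariate} {y : Fin n → Bool} {f : Covariate → ℝ}
    (hf : IsMLE (offsetClass γ) x y f) (hiso : 3 / 4 * (n : ℝ) ≤ (isolated (2 * ρ) x).card)
    (J : ℕ) :
    n * ρ ^ γ / 1024 ≤ 4 * offset f * chainSum (γ / 2) J x y +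
      7 / 256 * ρ ^ (γ / 2) * |∑ t, sgn (y t)| + 2 * (n * ((2 : ℝ) ^ J) ^ (-γ)) := by
  obtain ⟨g, hg, hgain⟩ :=
    exists_mem_offsetClass_le_logLik_sub ⟨hγ.1.le, hγ.2⟩ hρ₀ hρ₁ y hiso
  linarith [hf.2 g hg, logLik_sub_logLik_half_le_chainSum ⟨hγ.1, by linarith [hγ.2]⟩ x y hf.1 J]

/-! ### Typical samples -/

section Markov

lemma measure_ge_le_ofReal {Ω : Type*} [MeasurableSpace Ω] {μ : Measure Ω} {h : Ω → ℝ}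
    (hm : Measurable h) {c ε : ℝ} (hc : 0 < c)
    (hint : ∫⁻ s, ENNReal.ofReal (h s) ∂μ ≤ ENNReal.ofReal (ε * c)) :
    μ {s | c ≤ h s} ≤ ENNReal.ofReal ε := by
  have hc' : ENNReal.ofReal c ≠ 0 := (ENNReal.ofReal_pos.2 hc).ne'
  calc μ {s | c ≤ h s} ≤ μ {s | ENNReal.ofReal c ≤ ENNReal.ofReal (h s)} :=
        measure_mono fun s hs => ENNReal.ofReal_le_ofReal hs
    _ ≤ (∫⁻ s, ENNReal.ofReal (h s) ∂μ) / ENNReal.ofReal c :=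
        meas_ge_le_lintegral_div hm.ennreal_ofReal.aemeasurable hc' ENNReal.ofReal_ne_top
    _ ≤ ENNReal.ofReal ε := by
        rw [ENNReal.div_le_iff hc' ENNReal.ofReal_ne_top, ← ENNReal.ofReal_mul' hc.le]
        exact hint

variable {n : ℕ} {h : (Fin n → Covariate) × (Fin n → Bool) → ℝ}

lemma lintegral_ofReal_fairLaw_le (hm : Measurable h) (h₀ : ∀ s, 0 ≤ h s) {B : ℝ}
    (hB : ∀ x, ∫ y, h (x, y) ∂(Measure.pi fun _ => bern (1 / 2)) ≤ B) :
    ∫⁻ s, ENNReal.ofReal (h s) ∂(fairLaw n) ≤ ENNReal.ofReal B := by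
  rw [fairLaw, lintegral_prod _ hm.ennreal_ofReal.aemeasurable]
  calc ∫⁻ x, ∫⁻ y, ENNReal.ofReal (h (x, y)) ∂(Measure.pi fun _ => bern (1 / 2))
        ∂(Measure.pi fun _ => unif)
      ≤ ∫⁻ _, ENNReal.ofReal B ∂(Measure.pi fun _ => unif) := lintegral_mono fun x => by
        rw [← ofReal_integral_eq_lintegral_ofReal .of_finite (.of_forall fun y => h₀ _)]
        exact ENNReal.ofReal_le_ofReal (hB x)
    _ = ENNReal.ofReal B := by simp

lemma fairLaw_ge_le (hm : Measurable h) (h₀ : ∀ s, 0 ≤ h s) {c ε : ℝ} (hc : 0 < c)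
    (hB : ∀ x, ∫ y, h (x, y) ∂(Measure.pi fun _ => bern (1 / 2)) ≤ ε * c) :
    fairLaw n {s | c ≤ h s} ≤ ENNReal.ofReal ε :=
  measure_ge_le_ofReal hm hc (lintegral_ofReal_fairLaw_le hm h₀ hB)

end Markov

section Measurability

variable {ι : Type*} [Fintype ι]

lemma measurable_sum_binSample_sgn (m k : ℕ) :
    Measurable fun s : (ι → Covariate) × (ι → Bool) => ∑ t ∈ binSample m k s.1, sgn (s.2 t) := by
  have hbin (t : ι) : MeasurableSet {s : (ι → Covariate) × (ι → Bool) | bin m (s.1 t) = k} :=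
    ((measurable_bin m).comp (by fun_prop)) (measurableSet_singleton k)
  have hsgn (t : ι) : Measurable fun s : (ι → Covariate) × (ι → Bool) => sgn (s.2 t) :=
    (measurable_of_finite sgn).comp (by fun_prop)
  simp only [binSample, Finset.sum_filter]
  exact Finset.measurable_sum _ fun t _ => (hsgn t).ite (hbin t) measurable_const

lemma measurable_chainSum (α : ℝ) (J : ℕ) :
    Measurable fun s : (ι → Covariate) × (ι → Bool) => chainSum α J s.1 s.2 :=
  Finset.measurable_sum _ fun _ _ => (Finset.measurable_sum _ fun _ _ =>
    (measurable_sum_binSample_sgn _ _).abs).const_mul _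

lemma chainSum_nonneg (α : ℝ) (J : ℕ) (x : ι → Covariate) (y : ι → Bool) :
    0 ≤ chainSum α J x y :=
  Finset.sum_nonneg fun _ _ =>
    mul_nonneg (by positivity) (Finset.sum_nonneg fun _ _ => abs_nonneg _)

end Measurability

/-- The samples of size `n` on which the likelihood comparison is run: at most a quarter of the
points have another point within distance `2 * ρ`, and the sign sum and the chain sum are at most
`1 / ε` times the bounds for their (second and first) moments. -/
def typicalSamples (γ ε ρ : ℝ) (J n : ℕ) : Set ((Fin n → Covariate) × (Fin n → Bool)) :=
  {s | ((isolated (2 * ρ) s.1)ᶜ.card : ℝ) < n / 4 ∧ (∑ t, sgn (s.2 t)) ^ 2 < n / ε ∧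
    chainSum (γ / 2) J s.1 s.2 < chainConst (γ / 2) * √n * ((2 : ℝ) ^ J) ^ (1 / 2 - γ / 2) / ε}

section Typical

variable {γ ε ρ : ℝ} {J n : ℕ}

lemma measurable_card_compl_isolated_fst (r : ℝ) :
    Measurable fun s : (Fin n → Covariate) × (Fin n → Bool) => ((isolated r s.1)ᶜ.card : ℝ) := by
  simpa only [Function.comp_def, ENNReal.toReal_natCast] using
    ((measurable_card_compl_isolated r).comp measurable_fst).ennreal_toReal

lemma measurable_sq_sum_sgn :
    Measurable fun s : (Fin n → Covariate) × (Fin n → Bool) => (∑ t, sgn (s.2 t)) ^ 2 :=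
  ((measurable_of_finite fun y : Fin n → Bool => ∑ t, sgn (y t)).comp measurable_snd).pow_const 2

lemma measurableSet_typicalSamples : MeasurableSet (typicalSamples γ ε ρ J n) :=
  (measurableSet_lt (measurable_card_compl_isolated_fst _) measurable_const).inter
    ((measurableSet_lt measurable_sq_sum_sgn measurable_const).inter
      (measurableSet_lt (measurable_chainSum _ _) measurable_const))

lemma fairLaw_card_compl_isolated_ge_le (hn : 0 < n) (hρ : 16 * (n * ρ) ≤ ε) :
    fairLaw n {s | (n : ℝ) / 4 ≤ ((isolated (2 * ρ) s.1)ᶜ.card : ℝ)} ≤ ENNReal.ofReal ε := by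
  refine measure_ge_le_ofReal (measurable_card_compl_isolated_fst _) (by positivity) ?_
  simp only [ENNReal.ofReal_natCast]
  rw [fairLaw, measurePreserving_fst.lintegral_comp (measurable_card_compl_isolated (2 * ρ))]
  calc ∫⁻ x, ((isolated (2 * ρ) x)ᶜ.card : ℝ≥0∞) ∂(Measure.pi fun _ : Fin n => unif)
      ≤ n ^ 2 * ENNReal.ofReal (2 * (2 * ρ)) := by
        simpa only [Fintype.card_fin] using
          lintegral_card_compl_isolated_le (ι := Fin n) fun z => unif_ball_le z (2 * ρ)
    _ = ENNReal.ofReal (n ^ 2 * (2 * (2 * ρ))) := by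
        rw [← ENNReal.ofReal_natCast, ← ENNReal.ofReal_pow (by positivity),
          ← ENNReal.ofReal_mul (by positivity)]
    _ ≤ ENNReal.ofReal (ε * (n / 4)) :=
        ENNReal.ofReal_le_ofReal (by nlinarith [(Nat.cast_nonneg n : (0 : ℝ) ≤ n)])

lemma fairLaw_compl_typicalSamples_le (hγ : γ < 1) (hε : 0 < ε) (hn : 0 < n)
    (hρ : 16 * (n * ρ) ≤ ε) :
    fairLaw n (typicalSamples γ ε ρ J n)ᶜ ≤ ENNReal.ofReal (3 * ε) := by
  have hchain := chainConst_pos (α := γ / 2) (by linarith)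
  have : (0 : ℝ) < n := Nat.cast_pos.2 hn
  set c : ℝ := chainConst (γ / 2) * √n * ((2 : ℝ) ^ J) ^ (1 / 2 - γ / 2) / ε with hc
  have hsign : fairLaw n {s | (n : ℝ) / ε ≤ (∑ t, sgn (s.2 t)) ^ 2} ≤ ENNReal.ofReal ε :=
    fairLaw_ge_le measurable_sq_sum_sgn (fun _ => sq_nonneg _) (by positivity) fun _ => by
      rw [integral_sq_sum_sgn, Finset.card_univ, Fintype.card_fin, mul_div_cancel₀ _ hε.ne']
  have hsum : fairLaw n {s | c ≤ chainSum (γ / 2) J s.1 s.2} ≤ ENNReal.ofReal ε :=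
    fairLaw_ge_le (measurable_chainSum _ _) (fun _ => chainSum_nonneg _ _ _ _) (by positivity)
      fun x => by
        rw [hc, mul_div_cancel₀ _ hε.ne']
        simpa only [Fintype.card_fin] using
          integral_chainSum_le (α := γ / 2) (by linarith) J x
  calc fairLaw n (typicalSamples γ ε ρ J n)ᶜ
      ≤ fairLaw n ({s | (n : ℝ) / 4 ≤ ((isolated (2 * ρ) s.1)ᶜ.card : ℝ)} ∪
          ({s | (n : ℝ) / ε ≤ (∑ t, sgn (s.2 t)) ^ 2} ∪
            {s | c ≤ chainSum (γ / 2) J s.1 s.2})) := measure_mono fun s hs => by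
        simpa only [typicalSamples, Set.mem_compl_iff, Set.mem_ofPred_eq, Set.mem_union,
          not_and_or, not_lt] using hs
    _ ≤ ENNReal.ofReal ε + (ENNReal.ofReal ε + ENNReal.ofReal ε) :=
        (measure_union_le _ _).trans <| add_le_add (fairLaw_card_compl_isolated_ge_le hn hρ) <|
          (measure_union_le _ _).trans <| add_le_add hsign hsum
    _ = ENNReal.ofReal (3 * ε) := by
        rw [← ENNReal.ofReal_add hε.le hε.le, ← ENNReal.ofReal_add hε.le (by positivity)]
        ring_nf

end Typical

/-! ### The Hellinger loss of maximum likelihood estimates -/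

lemma mul_abs_le_of_sq_le {q N ε S L : ℝ} (hN : 0 ≤ N) (hε : 0 < ε) (hL : 0 < L)
    (hS : S ^ 2 ≤ N / ε) (hLN : L ^ 2 ≤ N * ε * q ^ 2) : q * |S| ≤ N * q ^ 2 / L := by
  refine le_of_sq_le_sq ?_ (by positivity)
  rw [le_div_iff₀ hε] at hS
  rw [div_pow, le_div_iff₀ (by positivity), mul_pow, sq_abs]
  calc q ^ 2 * S ^ 2 * L ^ 2 ≤ q ^ 2 * S ^ 2 * (N * ε * q ^ 2) := by gcongr
    _ = q ^ 2 * (S ^ 2 * ε) * (N * q ^ 2) := by ring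
    _ ≤ q ^ 2 * N * (N * q ^ 2) := by gcongr
    _ = (N * q ^ 2) ^ 2 := by ring

lemma exists_two_pow_mem_Icc {a : ℝ} (ha : 1 ≤ a) : ∃ J : ℕ, (2 : ℝ) ^ J ∈ Set.Icc a (2 * a) := by
  obtain ⟨k, hk₁, hk₂⟩ := exists_nat_pow_near ha one_lt_two
  exact ⟨k + 1, hk₂.le, by rw [pow_succ']; linarith⟩

lemma exists_two_pow_rpow_neg_le {γ ρ A : ℝ} (hγ : 0 < γ) (hρ₀ : 0 < ρ) (hρ₁ : ρ ≤ 1)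
    (hA : 1 ≤ A) :
    ∃ J : ℕ, ((2 : ℝ) ^ J) ^ (-γ) ≤ ρ ^ γ / A ∧ (2 : ℝ) ^ J ≤ 2 * A ^ γ⁻¹ / ρ := by
  have hone : 1 ≤ A ^ γ⁻¹ / ρ := by
    rw [one_le_div hρ₀]
    exact hρ₁.trans (Real.one_le_rpow hA (inv_nonneg.2 hγ.le))
  obtain ⟨J, hJ⟩ := exists_two_pow_mem_Icc hone
  refine ⟨J, ?_, by simpa only [mul_div_assoc] using hJ.2⟩
  calc ((2 : ℝ) ^ J) ^ (-γ) ≤ (A ^ γ⁻¹ / ρ) ^ (-γ) :=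
        Real.rpow_le_rpow_of_nonpos (by positivity) hJ.1 (neg_nonpos.2 hγ.le)
    _ = ρ ^ γ / A := by
        rw [Real.rpow_neg (by positivity), Real.div_rpow (by positivity) hρ₀.le,
          Real.rpow_inv_rpow (by positivity) hγ.ne', inv_div]

lemma IsMLE.le_offset_mul_of_mem_typicalSamples {γ ε ρ : ℝ} (hγ : γ ∈ Set.Ioo (0 : ℝ) 1)
    (hε : 0 < ε) (hρ₀ : 0 < ρ) (hρ₁ : ρ ≤ 1) {J n : ℕ} (hn : 112 ^ 2 ≤ n * ε * ρ ^ γ)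
    (hJ : ((2 : ℝ) ^ J) ^ (-γ) ≤ ρ ^ γ / 8192) {s : (Fin n → Covariate) × (Fin n → Bool)}
    (hs : s ∈ typicalSamples γ ε ρ J n) {f : Covariate → ℝ}
    (hf : IsMLE (offsetClass γ) s.1 s.2 f) :
    n * ρ ^ γ / 8192 ≤
      offset f * (chainConst (γ / 2) * √n * ((2 : ℝ) ^ J) ^ (1 / 2 - γ / 2) / ε) := by
  obtain ⟨hclose, hsign, hchain⟩ := hs
  have hiso : 3 / 4 * (n : ℝ) ≤ (isolated (2 * ρ) s.1).card := by
    have hcard : ((isolated (2 * ρ) s.1).card : ℝ) + (isolated (2 * ρ) s.1)ᶜ.card = n := by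
      exact_mod_cast (Finset.card_add_card_compl _).trans (Fintype.card_fin n)
    linarith
  have hqq : ρ ^ γ = (ρ ^ (γ / 2)) ^ 2 := by rw [sq, ← Real.rpow_add hρ₀, add_halves]
  have hsign' : ρ ^ (γ / 2) * |∑ t, sgn (s.2 t)| ≤ n * ρ ^ γ / 112 := by
    rw [hqq] at hn ⊢
    exact mul_abs_le_of_sq_le n.cast_nonneg hε (by norm_num) hsign.le hn
  have hmesh := mul_le_mul_of_nonneg_left hJ (Nat.cast_nonneg (α := ℝ) n)
  have hcore := hf.le_offset_mul_chainSum ⟨hγ.1, hγ.2.le⟩ hρ₀ hρ₁ hiso J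
  have hoffset := mul_le_mul_of_nonneg_left hchain.le hf.1.2.2.1
  linarith

lemma mul_rpow_le_of_le_mul_rpow {γ ρ N A D T o : ℝ} (hγ : γ ≤ 1) (hρ : 0 < ρ) (hN : 0 < N)
    (hA : 0 < A) (hT : 0 < T) (hD : 0 ≤ D) (hDT : D ≤ T / ρ) (ho : 0 ≤ o)
    (h : N * ρ ^ γ ≤ o * (A * √N * D ^ (1 / 2 - γ / 2))) :
    √(N * ρ) / (A * T ^ (1 / 2 - γ / 2)) * ρ ^ (γ / 2) ≤ o := by
  have he : 0 ≤ 1 / 2 - γ / 2 := by linarith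
  have hpow : N * ρ ^ γ * ρ ^ (1 / 2 - γ / 2) = √N * (√(N * ρ) * ρ ^ (γ / 2)) := by
    calc N * ρ ^ γ * ρ ^ (1 / 2 - γ / 2) = N * ρ ^ (1 / 2 + γ / 2) := by
          rw [mul_assoc, ← Real.rpow_add hρ]
          ring_nf
      _ = √N * √N * (√ρ * ρ ^ (γ / 2)) := by
          rw [Real.mul_self_sqrt hN.le, Real.sqrt_eq_rpow, ← Real.rpow_add hρ]
      _ = √N * (√(N * ρ) * ρ ^ (γ / 2)) := by
          rw [Real.sqrt_mul hN.le]
          ring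
  have hbound : √N * (√(N * ρ) * ρ ^ (γ / 2)) ≤ √N * (o * (A * T ^ (1 / 2 - γ / 2))) := by
    calc √N * (√(N * ρ) * ρ ^ (γ / 2)) = N * ρ ^ γ * ρ ^ (1 / 2 - γ / 2) := hpow.symm
      _ ≤ o * (A * √N * (T / ρ) ^ (1 / 2 - γ / 2)) * ρ ^ (1 / 2 - γ / 2) := by
          refine mul_le_mul_of_nonneg_right (h.trans ?_) (by positivity)
          gcongr
      _ = √N * (o * (A * T ^ (1 / 2 - γ / 2))) := by
          rw [Real.div_rpow hT.le hρ.le]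
          field_simp
  rw [div_mul_eq_mul_div, div_le_iff₀ (by positivity)]
  exact le_of_mul_le_mul_left hbound (Real.sqrt_pos.2 hN)

/-- The constant in the lower bound for the offset of maximum likelihood estimates, outside an
event of probability `3 * ε`. -/
def offsetConst (γ ε : ℝ) : ℝ :=
  √(ε / 16) / (8192 * (chainConst (γ / 2) / ε) * (2 * 8192 ^ γ⁻¹) ^ (1 / 2 - γ / 2))

lemma offsetConst_pos {γ ε : ℝ} (hγ : γ < 1) (hε : 0 < ε) : 0 < offsetConst γ ε := by
  have := chainConst_pos (α := γ / 2) (by linarith)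
  rw [offsetConst]
  positivity

lemma exists_typicalSamples_le_offset {γ ε : ℝ} (hγ : γ ∈ Set.Ioo (0 : ℝ) 1) (hε : 0 < ε) {n : ℕ}
    (hεn : ε / 16 / n ≤ 1) (hn : 112 ^ 2 ≤ n * ε * (ε / 16 / n) ^ γ) :
    ∃ J : ℕ, ∀ s ∈ typicalSamples γ ε (ε / 16 / n) J n, ∀ f, IsMLE (offsetClass γ) s.1 s.2 f →
      offsetConst γ ε * (ε / 16 / n) ^ (γ / 2) ≤ offset f := by
  have hn₀ : (0 : ℝ) < n := by
    refine n.cast_nonneg.lt_of_ne' fun h => ?_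
    rw [h] at hn
    norm_num at hn
  set ρ : ℝ := ε / 16 / n with hρ
  have hρ₀ : 0 < ρ := by positivity
  have hA := chainConst_pos (α := γ / 2) (by linarith [hγ.2])
  obtain ⟨J, hJ, hJ'⟩ :=
    exists_two_pow_rpow_neg_le hγ.1 hρ₀ hεn (A := 8192) (by norm_num)
  refine ⟨J, fun s hs f hf => ?_⟩
  have hcore := hf.le_offset_mul_of_mem_typicalSamples hγ hε hρ₀ hεn hn hJ hs
  have hNρ : n * ρ = ε / 16 := by rw [hρ]; field_simp
  rw [offsetConst, ← hNρ]
  refine mul_rpow_le_of_le_mul_rpow hγ.2.le hρ₀ hn₀ (by positivity) (by positivity)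
    (by positivity) hJ' hf.1.2.2.1 ?_
  calc n * ρ ^ γ = 8192 * (n * ρ ^ γ / 8192) := by ring
    _ ≤ 8192 * (offset f * (chainConst (γ / 2) * √n * ((2 : ℝ) ^ J) ^ (1 / 2 - γ / 2) / ε)) := by
        gcongr
    _ = offset f * (8192 * (chainConst (γ / 2) / ε) * √n * ((2 : ℝ) ^ J) ^ (1 / 2 - γ / 2)) := by
        ring

lemma eventually_le_mul_rpow_div {γ a : ℝ} (hγ : γ < 1) (ha : 0 < a) (L : ℝ) :
    ∀ᶠ n : ℕ in atTop, L ≤ n * (a / n) ^ γ := by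
  have htend : Tendsto (fun n : ℕ => a ^ γ * (n : ℝ) ^ (1 - γ)) atTop atTop :=
    ((tendsto_rpow_atTop (sub_pos.2 hγ)).comp tendsto_natCast_atTop_atTop).const_mul_atTop
      (Real.rpow_pos_of_pos ha γ)
  filter_upwards [htend.eventually_ge_atTop L, eventually_gt_atTop 0] with n hL hn
  have hn' : (0 : ℝ) < n := Nat.cast_pos.2 hn
  rwa [Real.div_rpow ha.le hn'.le, mul_div_left_comm, ← Real.rpow_one_sub' hn'.le (by linarith)]

theorem exists_eventually_le_hellingerLoss {γ ε : ℝ} (hγ : γ ∈ Set.Ioo (0 : ℝ) 1) (hε : 0 < ε) :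
    ∃ c : ℝ, 0 < c ∧ ∀ᶠ n : ℕ in atTop, ∃ G : Set ((Fin n → Covariate) × (Fin n → Bool)),
      MeasurableSet G ∧ fairLaw n Gᶜ ≤ ENNReal.ofReal ε ∧
      ∀ s ∈ G, ∀ f, IsMLE (offsetClass γ) s.1 s.2 f → c * (n : ℝ) ^ (-γ) ≤ hellingerLoss f := by
  set η : ℝ := ε / 3 with hη
  have hη₀ : 0 < η := by positivity
  have hκ := offsetConst_pos hγ.2 hη₀
  refine ⟨offsetConst γ η ^ 2 * (η / 16) ^ γ / 16, by positivity, ?_⟩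
  filter_upwards [eventually_le_mul_rpow_div hγ.2 (a := η / 16) (by positivity) (112 ^ 2 / η),
    eventually_gt_atTop 0, (tendsto_natCast_atTop_atTop (R := ℝ)).eventually_ge_atTop (η / 16)]
    with n hn hn₀ hηn
  have hn₀' : (0 : ℝ) < n := Nat.cast_pos.2 hn₀
  rw [div_le_iff₀ hη₀, mul_right_comm] at hn
  obtain ⟨J, hJ⟩ := exists_typicalSamples_le_offset hγ hη₀ (div_le_one_of_le₀ hηn hn₀'.le) hn
  have hspacing : 16 * (n * (η / 16 / n)) = η := by field_simp
  refine ⟨typicalSamples γ η (η / 16 / n) J n, measurableSet_typicalSamples,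
    (fairLaw_compl_typicalSamples_le hγ.2 hη₀ hn₀ hspacing.le).trans_eq ?_, fun s hs f hf => ?_⟩
  · rw [hη, mul_div_cancel₀ _ three_ne_zero]
  calc offsetConst γ η ^ 2 * (η / 16) ^ γ / 16 * (n : ℝ) ^ (-γ)
      = (offsetConst γ η * (η / 16 / n) ^ (γ / 2)) ^ 2 / 16 := by
        rw [mul_pow, ← Real.rpow_mul_natCast (by positivity), Nat.cast_two, div_mul_cancel₀ _
          two_ne_zero, Real.div_rpow (by positivity) hn₀'.le, Real.rpow_neg hn₀'.le]
        ring
    _ ≤ offset f ^ 2 / 16 := by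
        gcongr
        exact hJ s hs f hf
    _ ≤ hellingerLoss f := sq_offset_le_hellingerLoss hγ.1 hf.1

/-! ### Lower bounds for the maximum likelihood estimate -/

section MLE

variable {γ : ℝ}

theorem exists_le_liminf_innerProb {δ : ℝ} (hγ : γ ∈ Set.Ioo (0 : ℝ) 1) (hδ : 0 < δ) :
    ∃ C : ℝ, 0 < C ∧ ENNReal.ofReal (1 - δ) ≤
      liminf (fun n : ℕ => innerProb (fairLaw n) {s | ∀ f, IsMLE (offsetClass γ) s.1 s.2 f →
        C * (n : ℝ) ^ (-γ) ≤ hellingerLoss f}) atTop := by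
  obtain ⟨C, hC, hev⟩ := exists_eventually_le_hellingerLoss hγ hδ
  refine ⟨C, hC, le_liminf_of_le (by isBoundedDefault) (hev.mono ?_)⟩
  rintro n ⟨G, -, hGδ, hG⟩
  rw [innerProb, ENNReal.ofReal_sub _ hδ.le, ENNReal.ofReal_one]
  exact tsub_le_tsub_left ((measure_mono (Set.compl_subset_compl.2 hG)).trans hGδ) 1

lemma ofReal_half_le_measure {Ω : Type*} [MeasurableSpace Ω] {P : Measure Ω}
    [IsProbabilityMeasure P] {G : Set Ω} (hG : MeasurableSet G)
    (hGc : P Gᶜ ≤ ENNReal.ofReal (1 / 2)) : ENNReal.ofReal (1 / 2) ≤ P G := by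
  rw [show ENNReal.ofReal (1 / 2) = 1 - ENNReal.ofReal (1 / 2) by
    rw [← ENNReal.ofReal_one, ← ENNReal.ofReal_sub _ (by norm_num)]; norm_num,
    tsub_le_iff_right, ← prob_add_prob_compl (μ := P) hG]
  gcongr

lemma mul_fairLaw_le_klRisk {n : ℕ} {a : ℝ≥0∞}
    {G : Set ((Fin n → Covariate) × (Fin n → Bool))} (hG : MeasurableSet G)
    {e : (Fin n → Covariate) → (Fin n → Bool) → Covariate → ℝ}
    (ha : ∀ s ∈ G, a ≤ klLoss unif (fun _ => 1 / 2) (e s.1 s.2)) :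
    a * fairLaw n G ≤ klRisk e unif fun _ => 1 / 2 := by
  calc a * fairLaw n G = ∫⁻ s, G.indicator (fun _ => a) s ∂(fairLaw n) :=
        (lintegral_indicator_const hG a).symm
    _ = ∫⁻ x, ∫⁻ y, G.indicator (fun _ => a) (x, y)
          ∂(Measure.pi fun _ => bern (1 / 2)) ∂(Measure.pi fun _ => unif) :=
        lintegral_prod _ (measurable_const.indicator hG).aemeasurable
    _ ≤ klRisk e unif fun _ => 1 / 2 := lintegral_mono fun x => lintegral_mono fun y =>
        Set.indicator_apply_le' (ha (x, y)) fun _ => zero_le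

theorem exists_eventually_le_klRisk (hγ : γ ∈ Set.Ioo (0 : ℝ) 1) :
    ∃ c : ℝ, 0 < c ∧ ∀ᶠ n : ℕ in atTop, ∀ e : (Fin n → Covariate) → (Fin n → Bool) → Covariate → ℝ,
      (∀ x y, IsMLE (offsetClass γ) x y (e x y)) →
      ENNReal.ofReal (c * (n : ℝ) ^ (-γ)) ≤ klRisk e unif fun _ => 1 / 2 := by
  obtain ⟨c, hc, hev⟩ := exists_eventually_le_hellingerLoss hγ (one_half_pos (α := ℝ))
  refine ⟨c, hc, hev.mono ?_⟩
  rintro n ⟨G, hGm, hGc, hG⟩ e he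
  have : IsProbabilityMeasure (fairLaw n) := by unfold fairLaw; infer_instance
  calc ENNReal.ofReal (c * (n : ℝ) ^ (-γ))
      = ENNReal.ofReal (2 * (c * (n : ℝ) ^ (-γ))) * ENNReal.ofReal (1 / 2) := by
        rw [← ENNReal.ofReal_mul (by positivity)]
        ring_nf
    _ ≤ ENNReal.ofReal (2 * (c * (n : ℝ) ^ (-γ))) * fairLaw n G := by
        gcongr
        exact ofReal_half_le_measure hGm hGc
    _ ≤ klRisk e unif fun _ => 1 / 2 := by
        refine mul_fairLaw_le_klRisk hGm fun s hs => ?_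
        have hmle := he s.1 s.2
        refine le_trans (ENNReal.ofReal_le_ofReal ?_) (two_mul_hellingerLoss_le_klLoss
          (continuous_of_mem_offsetClass hγ.1 hmle.1).measurable
          (mem_Ioo_of_mem_offsetClass hγ.1 hmle.1))
        gcongr
        exact hG s hs _ hmle

end MLE

/-! ### The regressogram and the minimax risk -/

section Counting

variable {Ω : Type*} [MeasurableSpace Ω] {p : Ω → Prop} [DecidablePred p] {n : ℕ}

lemma measurable_card_filter {ι : Type*} [Fintype ι] (hp : MeasurableSet {z | p z}) :
    Measurable fun x : ι → Ω => ((Finset.card {t | p (x t)} : ℕ) : ℝ≥0∞) := by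
  simp only [Finset.card_filter, Nat.cast_sum, Nat.cast_ite, Nat.cast_one, Nat.cast_zero]
  exact Finset.measurable_sum _ fun t _ =>
    Measurable.ite (measurable_pi_apply t hp) measurable_const measurable_const

lemma lintegral_ite_inv_card_filter (μ : Measure Ω) [IsProbabilityMeasure μ]
    (hp : MeasurableSet {z | p z}) (i : Fin (n + 1)) :
    ∫⁻ x : Fin (n + 1) → Ω, (if p (x i) then ((Finset.card {t | p (x t)} : ℕ) : ℝ≥0∞)⁻¹ else 0)
        ∂(Measure.pi fun _ => μ) =
      μ {z | p z} * ∫⁻ x : Fin n → Ω, (1 + ((Finset.card {t | p (x t)} : ℕ) : ℝ≥0∞))⁻¹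
        ∂(Measure.pi fun _ => μ) := by
  have hmeas : Measurable fun x : Fin n → Ω =>
      (1 + ((Finset.card {t | p (x t)} : ℕ) : ℝ≥0∞))⁻¹ :=
    ((measurable_card_filter hp).const_add 1).inv
  have hsplit (x : Fin (n + 1) → Ω) :
      (if p (x i) then ((Finset.card {t | p (x t)} : ℕ) : ℝ≥0∞)⁻¹ else 0) =
        {z | p z}.indicator 1 (x i) *
          (1 + ((Finset.card {t | p (i.removeNth x t)} : ℕ) : ℝ≥0∞))⁻¹ := by
    by_cases hi : p (x i)
    · have hcard : Finset.card {t | p (x t)} = 1 + Finset.card {t | p (i.removeNth x t)} := by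
        rw [Finset.card_filter, Fin.sum_univ_succAbove _ i, if_pos hi, Finset.card_filter]
        rfl
      simp [hi, hcard]
    · simp [hi]
  rw [lintegral_congr hsplit, ← lintegral_indicator_one hp, ← lintegral_prod_mul
    (measurable_one.indicator hp).aemeasurable hmeas.aemeasurable]
  exact (measurePreserving_piFinSuccAbove (fun _ => μ) i).lintegral_comp
    (((measurable_one.indicator hp).comp measurable_fst).mul (hmeas.comp measurable_snd))

-- In a sample of size `n + 1`, split a unit mass equally among the observations that satisfy `p`:
-- by exchangeability the left side is the expected share of each of the `n + 1` observations.
lemma measure_mul_lintegral_inv_card_filter_le (μ : Measure Ω) [IsProbabilityMeasure μ]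
    (hp : MeasurableSet {z | p z}) :
    μ {z | p z} * ∫⁻ x : Fin n → Ω, (1 + ((Finset.card {t | p (x t)} : ℕ) : ℝ≥0∞))⁻¹
      ∂(Measure.pi fun _ => μ) ≤ ((n + 1 : ℕ) : ℝ≥0∞)⁻¹ := by
  rw [ENNReal.le_inv_iff_mul_le, mul_comm, ← nsmul_eq_mul, ← Fintype.card_fin (n + 1),
    ← Finset.card_univ, ← Finset.sum_const]
  have hshare (x : Fin (n + 1) → Ω) :
      ∑ i, (if p (x i) then ((Finset.card {t | p (x t)} : ℕ) : ℝ≥0∞)⁻¹ else 0) ≤ 1 := by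
    rw [← Finset.sum_filter, Finset.sum_const, nsmul_eq_mul]
    exact ENNReal.mul_inv_le_one _
  calc ∑ _i : Fin (n + 1), μ {z | p z} *
        ∫⁻ x : Fin n → Ω, (1 + ((Finset.card {t | p (x t)} : ℕ) : ℝ≥0∞))⁻¹
          ∂(Measure.pi fun _ => μ)
      = ∑ i, ∫⁻ x : Fin (n + 1) → Ω, (if p (x i) then
          ((Finset.card {t | p (x t)} : ℕ) : ℝ≥0∞)⁻¹ else 0) ∂(Measure.pi fun _ => μ) :=
        Finset.sum_congr rfl fun i _ => (lintegral_ite_inv_card_filter μ hp i).symm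
    _ = ∫⁻ x : Fin (n + 1) → Ω, ∑ i, (if p (x i) then
          ((Finset.card {t | p (x t)} : ℕ) : ℝ≥0∞)⁻¹ else 0) ∂(Measure.pi fun _ => μ) :=
        (lintegral_finsetSum _ fun i _ => Measurable.ite (measurable_pi_apply i hp)
          (measurable_card_filter hp).inv measurable_const).symm
    _ ≤ 1 := (lintegral_mono hshare).trans_eq (by simp)

end Counting

lemma lintegral_comp_bin (μ : Measure Covariate) (m : ℕ) (Ψ : ℕ → ℝ≥0∞) :
    ∫⁻ z, Ψ (bin m z) ∂μ = ∑ k ∈ Finset.range (m + 1), Ψ k * μ {z | bin m z = k} := by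
  have hmeas (k : ℕ) : MeasurableSet {z | bin m z = k} :=
    measurable_bin m (measurableSet_singleton k)
  calc ∫⁻ z, Ψ (bin m z) ∂μ
      = ∫⁻ z, ∑ k ∈ Finset.range (m + 1), {z | bin m z = k}.indicator (fun _ => Ψ k) z ∂μ := by
        refine lintegral_congr fun z => ?_
        simp only [Set.indicator_apply, Set.mem_ofPred_eq]
        rw [Finset.sum_ite_eq, if_pos (bin_mem_range m z)]
    _ = ∑ k ∈ Finset.range (m + 1), Ψ k * μ {z | bin m z = k} := by
        rw [lintegral_finsetSum _ fun k _ => measurable_const.indicator (hmeas k)]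
        simp only [lintegral_indicator_const (hmeas _)]

lemma sq_sub_shrunken_mean_le {ι : Type*} (s : Finset ι) (u : ι → ℝ) {a : ι → ℝ} {b v h : ℝ}
    (hb : |v - b| ≤ 1) (ha : ∀ t ∈ s, |a t - v| ≤ h) :
    (v - (b + ∑ t ∈ s, u t) / (1 + s.card)) ^ 2 ≤
      3 * (h ^ 2 + (1 + (∑ t ∈ s, (u t - a t)) ^ 2) / (1 + s.card) ^ 2) := by
  set N : ℝ := (s.card : ℝ)
  set V : ℝ := ∑ t ∈ s, (u t - a t) with hV
  set W : ℝ := ∑ t ∈ s, (a t - v) with hW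
  have hN : 0 < 1 + N := by positivity
  have hbias : |W| ≤ N * h := by
    rw [← nsmul_eq_mul, ← Finset.sum_const]
    exact (Finset.abs_sum_le_sum_abs _ _).trans (Finset.sum_le_sum ha)
  have hbias_sq : W ^ 2 ≤ (1 + N) ^ 2 * h ^ 2 := by
    calc W ^ 2 = |W| ^ 2 := (sq_abs W).symm
      _ ≤ (N * h) ^ 2 := by gcongr
      _ ≤ (1 + N) ^ 2 * h ^ 2 := by rw [mul_pow]; gcongr; linarith
  have hdecomp : v - (b + ∑ t ∈ s, u t) / (1 + N) = ((v - b) - V - W) / (1 + N) := by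
    rw [hV, hW, Finset.sum_sub_distrib, Finset.sum_sub_distrib, Finset.sum_const, nsmul_eq_mul]
    field_simp
    ring
  have hpow : (v - b - V - W) ^ 2 ≤ 3 * ((v - b) ^ 2 + V ^ 2 + W ^ 2) := by
    linarith [sq_nonneg (v - b + V), sq_nonneg (v - b + W), sq_nonneg (V - W)]
  have hb_sq : (v - b) ^ 2 ≤ 1 := (sq_le_one_iff_abs_le_one _).2 hb
  rw [hdecomp, div_pow, div_le_iff₀ (by positivity), mul_assoc, add_mul,
    div_mul_cancel₀ _ (by positivity)]
  linarith

lemma klDiv_bern_le_five_mul_sq {a b : ℝ} (ha : a ∈ Set.Icc (0 : ℝ) 1)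
    (hb : b ∈ Set.Icc (7 / 16 : ℝ) (9 / 16)) :
    klDiv (bern a) (bern b) ≤ ENNReal.ofReal (5 * (a - b) ^ 2) := by
  obtain ⟨hlb, hub⟩ := hb
  refine (klDiv_bern_le_chiSq ha ⟨by linarith, by linarith⟩).trans (ENNReal.ofReal_le_ofReal ?_)
  have hvar : 1 / 5 ≤ b * (1 - b) := by nlinarith
  rw [div_le_iff₀ (by linarith)]
  nlinarith [sq_nonneg (a - b)]

section Regressogram

variable {n m : ℕ}

/-- The regressogram: on each bin of length `1 / m`, the mean of the responses in this bin and of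
one artificial response `1 / 2`, clipped to the range `[7/16, 9/16]` of the class. -/
def regressogram (m : ℕ) (x : Fin n → Covariate) (y : Fin n → Bool) (z : Covariate) : ℝ :=
  Set.projIcc (7 / 16 : ℝ) (9 / 16) (by norm_num)
    ((1 / 2 + ∑ t ∈ binSample m (bin m z) x, ((y t).toNat : ℝ)) /
      (1 + (binSample m (bin m z) x).card))

lemma regressogram_mem_Icc (m : ℕ) (x : Fin n → Covariate) (y : Fin n → Bool) (z : Covariate) :
    regressogram m x y z ∈ Set.Icc (7 / 16 : ℝ) (9 / 16) :=
  Subtype.prop _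

lemma isEstimator_regressogram (m : ℕ) : IsEstimator (regressogram (n := n) m) where
  mem_Icc x y z := Set.Icc_subset_Icc (by norm_num) (by norm_num) (regressogram_mem_Icc m x y z)
  measurable := by
    have hmem (t : Fin n) : MeasurableSet {p : ((Fin n → Covariate) × (Fin n → Bool)) × Covariate |
        bin m (p.1.1 t) = bin m p.2} :=
      measurableSet_eq_fun ((measurable_bin m).comp (by fun_prop))
        ((measurable_bin m).comp measurable_snd)
    have htoNat : Measurable fun b : Bool => (b.toNat : ℝ) := measurable_of_finite _
    simp only [regressogram, binSample, Finset.sum_filter, Finset.card_filter, Nat.cast_sum,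
      Nat.cast_ite, Nat.cast_one, Nat.cast_zero]
    refine measurable_subtype_coe.comp (continuous_projIcc.measurable.comp (Measurable.div ?_ ?_))
    · exact (Finset.measurable_sum _ fun t _ =>
        Measurable.ite (hmem t) (htoNat.comp (by fun_prop)) measurable_const).const_add _
    · exact (Finset.measurable_sum _ fun t _ =>
        Measurable.ite (hmem t) measurable_const measurable_const).const_add _

/-- The bound `h ^ 2 + (1 + V ^ 2) / (1 + N) ^ 2` for the squared error of the regressogram on the
`k`-th bin, up to a constant factor: `h` bounds the oscillation of the conditional mean `f` on the
bin, `N` is the number of observations in the bin, and `V` is the sum of their noises. -/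
def binError (h : ℝ) (f : Covariate → ℝ) (m k : ℕ) (x : Fin n → Covariate) (y : Fin n → Bool) :
    ℝ :=
  h ^ 2 + (1 + (∑ t ∈ binSample m k x, ((y t).toNat - f (x t))) ^ 2) /
    (1 + (binSample m k x).card) ^ 2

lemma klDiv_regressogram_le {f : Covariate → ℝ} {h : ℝ}
    (hf : ∀ z, f z ∈ Set.Icc (7 / 16 : ℝ) (9 / 16))
    (hosc : ∀ z w, bin m z = bin m w → |f z - f w| ≤ h)
    (x : Fin n → Covariate) (y : Fin n → Bool) (z : Covariate) :
    klDiv (bern (f z)) (bern (regressogram m x y z)) ≤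
      ENNReal.ofReal (15 * binError h f m (bin m z) x y) := by
  obtain ⟨hlb, hub⟩ := hf z
  refine (klDiv_bern_le_five_mul_sq ⟨by linarith, by linarith⟩
    (regressogram_mem_Icc m x y z)).trans (ENNReal.ofReal_le_ofReal ?_)
  have hclip : (f z - regressogram m x y z) ^ 2 ≤
      (f z - (1 / 2 + ∑ t ∈ binSample m (bin m z) x, ((y t).toNat : ℝ)) /
        (1 + (binSample m (bin m z) x).card)) ^ 2 := by
    have hcontr := Set.abs_projIcc_sub_projIcc (c := f z)
      (d := (1 / 2 + ∑ t ∈ binSample m (bin m z) x, ((y t).toNat : ℝ)) /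
        (1 + (binSample m (bin m z) x).card)) (show (7 / 16 : ℝ) ≤ 9 / 16 by norm_num)
    rw [Set.projIcc_of_mem _ (hf z)] at hcontr
    exact sq_le_sq.2 hcontr
  have hmean := sq_sub_shrunken_mean_le (binSample m (bin m z) x) (fun t => ((y t).toNat : ℝ))
    (a := fun t => f (x t)) (b := 1 / 2) (abs_le.2 ⟨by linarith, by linarith⟩)
    fun t ht => hosc (x t) z (Finset.mem_filter.1 ht).2
  rw [binError]
  linarith

lemma integral_binError_le {f : Covariate → ℝ} (hf : ∀ z, f z ∈ Set.Icc (0 : ℝ) 1)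
    (h : ℝ) (m k : ℕ) (x : Fin n → Covariate) :
    ∫ y, binError h f m k x y ∂(Measure.pi fun t => bern (f (x t))) ≤
      h ^ 2 + (1 + ((binSample m k x).card : ℝ))⁻¹ := by
  set N : ℝ := ((binSample m k x).card : ℝ) with hN
  have hvar : ∑ t ∈ binSample m k x, f (x t) * (1 - f (x t)) ≤ N := by
    rw [hN, ← nsmul_one, ← Finset.sum_const]
    exact Finset.sum_le_sum fun t _ => mul_le_one₀ (hf _).2 (by linarith [(hf (x t)).2])
      (by linarith [(hf (x t)).1])
  simp only [binError]
  rw [integral_add .of_finite .of_finite, integral_div, integral_add .of_finite .of_finite,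
    integral_sq_sum_toNat_sub fun t => hf (x t)]
  simp only [integral_const, probReal_univ, one_smul, ← hN]
  gcongr
  calc (1 + ∑ t ∈ binSample m k x, f (x t) * (1 - f (x t))) / (1 + N) ^ 2
      ≤ (1 + N) / (1 + N) ^ 2 := by gcongr
    _ = (1 + N)⁻¹ := by field_simp

lemma lintegral_klLoss_regressogram_le {f : Covariate → ℝ} {h : ℝ}
    (hf : ∀ z, f z ∈ Set.Icc (7 / 16 : ℝ) (9 / 16))
    (hosc : ∀ z w, bin m z = bin m w → |f z - f w| ≤ h)
    (μ : Measure Covariate) (x : Fin n → Covariate) :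
    ∫⁻ y, klLoss μ f (regressogram m x y) ∂(Measure.pi fun t => bern (f (x t))) ≤
      ∑ k ∈ Finset.range (m + 1), 15 * (ENNReal.ofReal (h ^ 2) +
        (1 + ((binSample m k x).card : ℝ≥0∞))⁻¹) * μ {z | bin m z = k} := by
  have hf01 (z : Covariate) : f z ∈ Set.Icc (0 : ℝ) 1 :=
    Set.Icc_subset_Icc (by norm_num) (by norm_num) (hf z)
  have hloss (y : Fin n → Bool) : klLoss μ f (regressogram m x y) ≤
      ∑ k ∈ Finset.range (m + 1),
        ENNReal.ofReal (15 * binError h f m k x y) * μ {z | bin m z = k} :=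
    (lintegral_mono fun z => klDiv_regressogram_le hf hosc x y z).trans_eq
      (lintegral_comp_bin μ m fun k => ENNReal.ofReal (15 * binError h f m k x y))
  refine (lintegral_mono hloss).trans ?_
  rw [lintegral_finsetSum _ fun k _ => measurable_of_finite _]
  refine Finset.sum_le_sum fun k _ => ?_
  rw [lintegral_mul_const _ (measurable_of_finite _),
    ← ofReal_integral_eq_lintegral_ofReal .of_finite
      (ae_of_all _ fun y => by rw [binError, Pi.zero_apply]; positivity), integral_const_mul]
  gcongr
  calc ENNReal.ofReal (15 * ∫ y, binError h f m k x y ∂(Measure.pi fun t => bern (f (x t))))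
      ≤ ENNReal.ofReal (15 * (h ^ 2 + (1 + ((binSample m k x).card : ℝ))⁻¹)) := by
        gcongr
        exact integral_binError_le hf01 h m k x
    _ = 15 * (ENNReal.ofReal (h ^ 2) + (1 + ((binSample m k x).card : ℝ≥0∞))⁻¹) := by
        rw [ENNReal.ofReal_mul (by norm_num), ENNReal.ofReal_add (by positivity) (by positivity),
          ENNReal.ofReal_inv_of_pos (by positivity), ENNReal.ofReal_add zero_le_one (by positivity),
          ENNReal.ofReal_one, ENNReal.ofReal_natCast, ENNReal.ofReal_ofNat]

lemma klRisk_regressogram_le {f : Covariate → ℝ} {h : ℝ}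
    (hf : ∀ z, f z ∈ Set.Icc (7 / 16 : ℝ) (9 / 16))
    (hosc : ∀ z w, bin m z = bin m w → |f z - f w| ≤ h)
    (μ : Measure Covariate) [IsProbabilityMeasure μ] :
    klRisk (n := n) (regressogram m) μ f ≤
      ENNReal.ofReal (15 * (h ^ 2 + (m + 1) / (n + 1))) := by
  have hmeas (k : ℕ) : MeasurableSet {z | bin m z = k} :=
    measurable_bin m (measurableSet_singleton k)
  have hcount (k : ℕ) : Measurable fun x : Fin n → Covariate =>
      (1 + ((binSample m k x).card : ℝ≥0∞))⁻¹ :=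
    ((measurable_card_filter (hmeas k)).const_add 1).inv
  have hmass : ∑ k ∈ Finset.range (m + 1), μ {z | bin m z = k} = 1 := by
    simpa using (lintegral_comp_bin μ m fun _ => 1).symm
  refine (lintegral_mono (lintegral_klLoss_regressogram_le hf hosc μ)).trans ?_
  rw [lintegral_finsetSum _ fun k _ => (((hcount k).const_add _).const_mul _).mul_const _]
  calc ∑ k ∈ Finset.range (m + 1), ∫⁻ x : Fin n → Covariate, 15 * (ENNReal.ofReal (h ^ 2) +
          (1 + ((binSample m k x).card : ℝ≥0∞))⁻¹) * μ {z | bin m z = k} ∂(Measure.pi fun _ => μ)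
      = ∑ k ∈ Finset.range (m + 1), 15 * (ENNReal.ofReal (h ^ 2) * μ {z | bin m z = k} +
          μ {z | bin m z = k} * ∫⁻ x : Fin n → Covariate,
            (1 + ((binSample m k x).card : ℝ≥0∞))⁻¹ ∂(Measure.pi fun _ => μ)) := by
        refine Finset.sum_congr rfl fun k _ => ?_
        rw [lintegral_mul_const _ (((hcount k).const_add _).const_mul _),
          lintegral_const_mul _ ((hcount k).const_add _), lintegral_add_left measurable_const,
          lintegral_const, measure_univ]
        ring
    _ ≤ ∑ k ∈ Finset.range (m + 1), 15 * (ENNReal.ofReal (h ^ 2) * μ {z | bin m z = k} +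
          ((n + 1 : ℕ) : ℝ≥0∞)⁻¹) := by
        gcongr with k
        exact measure_mul_lintegral_inv_card_filter_le μ (hmeas k)
    _ = ENNReal.ofReal (15 * (h ^ 2 + (m + 1) / (n + 1))) := by
        rw [← Finset.mul_sum, Finset.sum_add_distrib, ← Finset.mul_sum, hmass, Finset.sum_const,
          Finset.card_range, nsmul_eq_mul, mul_one, ENNReal.ofReal_mul (by norm_num),
          ENNReal.ofReal_add (by positivity) (by positivity),
          ENNReal.ofReal_div_of_pos (by positivity), div_eq_mul_inv, ENNReal.ofReal_ofNat]
        norm_cast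

theorem minimaxRisk_offsetClass_le {γ : ℝ} (hγ : 0 < γ) (hn : 0 < n) :
    minimaxRisk (offsetClass γ) n ≤
      ENNReal.ofReal (60 * (n : ℝ) ^ (-(2 * γ / (2 * γ + 1)))) := by
  have hn₁ : (1 : ℝ) ≤ n := Nat.one_le_cast.2 hn
  have hn₀ : (0 : ℝ) < n := by linarith
  set R : ℝ := (n : ℝ) ^ (-(2 * γ / (2 * γ + 1))) with hR
  set B : ℝ := (n : ℝ) ^ (1 / (2 * γ + 1)) with hB
  have hB₁ : 1 ≤ B := Real.one_le_rpow hn₁ (by positivity)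
  have hm : 0 < ⌈B⌉₊ := Nat.ceil_pos.2 (by linarith)
  refine (iInf₂_le (regressogram ⌈B⌉₊) (isEstimator_regressogram _)).trans
    (iSup₂_le fun μ _ => iSup₂_le fun f hf => ?_)
  have hosc (z w : Covariate) (hzw : bin ⌈B⌉₊ z = bin ⌈B⌉₊ w) : |f z - f w| ≤ B⁻¹ ^ γ :=
    (hf.1 z w).trans (Real.rpow_le_rpow dist_nonneg ((dist_le_of_bin_eq hm hzw).trans
      (inv_anti₀ (by positivity) (Nat.le_ceil B))) hγ.le)
  have hbias : (B⁻¹ ^ γ) ^ 2 = R := by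
    rw [hB, hR, ← Real.rpow_neg hn₀.le, ← Real.rpow_mul hn₀.le, ← Real.rpow_mul_natCast hn₀.le]
    congr 1
    push_cast
    field_simp
  have hnoise : (⌈B⌉₊ + 1) / ((n : ℝ) + 1) ≤ 3 * R := by
    calc (⌈B⌉₊ + 1) / ((n : ℝ) + 1) ≤ 3 * B / n := by
          gcongr
          · linarith [Nat.ceil_lt_add_one (zero_le_one.trans hB₁)]
          · linarith
      _ = 3 * R := by
          rw [mul_div_assoc, hB, hR, ← Real.rpow_sub_one hn₀.ne']
          congr 2
          field_simp
          ring
  refine (klRisk_regressogram_le (mem_Icc_of_mem_offsetClass hγ hf) hosc μ).trans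
    (ENNReal.ofReal_le_ofReal ?_)
  rw [hbias]
  linarith

end Regressogram

/-! ### Comparison of rates -/

lemma mul_log_rpow_neg_le {γ : ℝ} (hγ : 0 ≤ γ) {n : ℕ} (hn : 3 ≤ n) :
    ((n : ℝ) * Real.log n) ^ (-γ) ≤ (n : ℝ) ^ (-γ) := by
  have hn₃ : (3 : ℝ) ≤ n := Nat.ofNat_le_cast.2 hn
  have hlog : 1 ≤ Real.log n :=
    (Real.le_log_iff_exp_le (by linarith)).2 (Real.exp_one_lt_three.le.trans hn₃)
  exact Real.rpow_le_rpow_of_nonpos (by linarith)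
    (le_mul_of_one_le_right (by linarith) hlog) (neg_nonpos.2 hγ)

lemma liminf_innerProb_le_liminf_innerProb_log (F : Set (Covariate → ℝ)) {γ C : ℝ} (hγ : 0 ≤ γ)
    (hC : 0 ≤ C) :
    liminf (fun n : ℕ => innerProb (fairLaw n) {s | ∀ f, IsMLE F s.1 s.2 f →
        C * (n : ℝ) ^ (-γ) ≤ hellingerLoss f}) atTop ≤
      liminf (fun n : ℕ => innerProb (fairLaw n) {s | ∀ f, IsMLE F s.1 s.2 f →
        C * ((n : ℝ) * Real.log n) ^ (-γ) ≤ hellingerLoss f}) atTop := by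
  refine liminf_le_liminf ((eventually_ge_atTop 3).mono fun n hn => ?_)
  refine tsub_le_tsub_left (measure_mono (Set.compl_subset_compl.2 fun s hs f hf => ?_)) 1
  exact (mul_le_mul_of_nonneg_left (mul_log_rpow_neg_le hγ hn) hC).trans (hs f hf)

lemma eventually_mul_rpow_neg_lt {α β c : ℝ} (hαβ : α < β) (hc : 0 < c) (L : ℝ) :
    ∀ᶠ n : ℕ in atTop, L * (n : ℝ) ^ (-β) < c * (n : ℝ) ^ (-α) := by
  have hgap := ((tendsto_rpow_atTop (sub_pos.2 hαβ)).comp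
    tendsto_natCast_atTop_atTop).eventually_gt_atTop (L / c)
  filter_upwards [hgap, eventually_gt_atTop 0] with n hn hn₀
  have hn₀' : (0 : ℝ) < n := Nat.cast_pos.2 hn₀
  calc L * (n : ℝ) ^ (-β) < (n : ℝ) ^ (β - α) * c * (n : ℝ) ^ (-β) := by
        gcongr
        exact (div_lt_iff₀ hc).1 hn
    _ = c * (n : ℝ) ^ (-α) := by
        rw [mul_comm _ c, mul_assoc, ← Real.rpow_add hn₀']
        ring_nf

lemma eventually_mul_lt_of_le_rpow_of_rpow_le {u v : ℕ → ℝ≥0∞} {α β c K : ℝ} (hαβ : α < β)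
    (hc : 0 < c) (hu : ∀ n : ℕ, 1 ≤ n → u n ≤ ENNReal.ofReal (K * (n : ℝ) ^ (-β)))
    (hv : ∀ᶠ n : ℕ in atTop, ENNReal.ofReal (c * (n : ℝ) ^ (-α)) ≤ v n) (M : NNReal) :
    ∀ᶠ n in atTop, M * u n < v n := by
  filter_upwards [hv, eventually_mul_rpow_neg_lt hαβ hc (M * K), eventually_ge_atTop 1]
    with n hvn hlt hn
  have : (0 : ℝ) < n := Nat.cast_pos.2 hn
  calc (M : ℝ≥0∞) * u n ≤ M * ENNReal.ofReal (K * (n : ℝ) ^ (-β)) := by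
        gcongr
        exact hu n hn
    _ = ENNReal.ofReal (M * K * (n : ℝ) ^ (-β)) := by
        rw [mul_assoc, ENNReal.ofReal_mul M.coe_nonneg, ENNReal.ofReal_coe_nnreal]
    _ < ENNReal.ofReal (c * (n : ℝ) ^ (-α)) :=
        (ENNReal.ofReal_lt_ofReal_iff (by positivity)).2 hlt
    _ ≤ v n := hvn

end CondDensity

end

theorem theorem6_general (γ : ℝ) (hγ : γ ∈ Set.Ioo (0 : ℝ) 1) :
    ∃ F : Set (CondDensity.Covariate → ℝ),
      Convex ℝ F ∧
      (∀ f ∈ F, HolderWith 1 γ.toNNReal f ∧ ∀ x, f x ∈ Set.Icc (7 / 16 : ℝ) (9 / 16)) ∧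
      (fun _ => (1 / 2 : ℝ)) ∈ F ∧
      (∀ (n : ℕ) (x : Fin n → CondDensity.Covariate) (y : Fin n → Bool),
        ∃ f, CondDensity.IsMLE F x y f) ∧
      (∀ δ : ℝ, 0 < δ → ∃ C : ℝ, 0 < C ∧
        ENNReal.ofReal (1 - δ) ≤
          liminf (fun n : ℕ => CondDensity.innerProb (CondDensity.fairLaw n)
            {s | ∀ f, CondDensity.IsMLE F s.1 s.2 f →
              C * (n : ℝ) ^ (-γ) ≤ CondDensity.hellingerLoss f}) atTop) ∧
      (∃ K : ℝ, 0 < K ∧ ∀ n : ℕ, 1 ≤ n →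
        CondDensity.minimaxRisk F n ≤
          ENNReal.ofReal (K * (n : ℝ) ^ (-(2 * γ / (2 * γ + 1))))) ∧
      (∃ c : ℝ, 0 < c ∧ ∀ᶠ n : ℕ in atTop,
        ∀ e : (Fin n → CondDensity.Covariate) → (Fin n → Bool) → CondDensity.Covariate → ℝ,
          (∀ x y, CondDensity.IsMLE F x y (e x y)) →
          ENNReal.ofReal (c * (n : ℝ) ^ (-γ)) ≤
            CondDensity.klRisk e CondDensity.unif (fun _ => 1 / 2)) :=
  ⟨CondDensity.offsetClass γ, CondDensity.convex_offsetClass γ,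
    fun _ hf => ⟨CondDensity.holderWith_of_mem_offsetClass hγ.1 hf,
      CondDensity.mem_Icc_of_mem_offsetClass hγ.1 hf⟩,
    CondDensity.half_mem_offsetClass γ,
    fun _ => CondDensity.exists_isMLE_offsetClass hγ.1,
    fun _ => CondDensity.exists_le_liminf_innerProb hγ,
    ⟨60, by norm_num, fun _ => CondDensity.minimaxRisk_offsetClass_le hγ.1⟩,
    CondDensity.exists_eventually_le_klRisk hγ⟩

theorem theorem6 (γ : ℝ) (hγ : γ ∈ Set.Ioo (0 : ℝ) (1 / 2)) :
    ∃ F : Set (CondDensity.Covariate → ℝ),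
      -- a convex class of `γ`-Hölder maps into `[7/16, 9/16]`, containing the truth `1/2`
      Convex ℝ F ∧
      (∀ f ∈ F, HolderWith 1 γ.toNNReal f ∧ ∀ x, f x ∈ Set.Icc (7 / 16 : ℝ) (9 / 16)) ∧
      (fun _ => (1 / 2 : ℝ)) ∈ F ∧
      -- a maximum likelihood estimate exists on every sample
      (∀ (n : ℕ) (x : Fin n → CondDensity.Covariate) (y : Fin n → Bool),
        ∃ f, CondDensity.IsMLE F x y f) ∧
      -- lower bound on the Hellinger loss, simultaneously for all maximum likelihood estimates
      (∀ δ : ℝ, 0 < δ → ∃ C : ℝ, 0 < C ∧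
        ENNReal.ofReal (1 - δ) ≤
          liminf (fun n : ℕ => CondDensity.innerProb (CondDensity.fairLaw n)
            {s | ∀ f, CondDensity.IsMLE F s.1 s.2 f →
              C * ((n : ℝ) * Real.log n) ^ (-γ) ≤ CondDensity.hellingerLoss f}) atTop) ∧
      -- the minimax risk is at most of order `n^{-2γ/(2γ+1)}`
      (∃ K : ℝ, 0 < K ∧ ∀ n : ℕ, 1 ≤ n →
        CondDensity.minimaxRisk F n ≤
          ENNReal.ofReal (K * (n : ℝ) ^ (-(2 * γ / (2 * γ + 1))))) ∧
      -- no maximum likelihood estimator attains the order of the minimax risk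
      (∀ mle : (n : ℕ) → (Fin n → CondDensity.Covariate) → (Fin n → Bool) →
          CondDensity.Covariate → ℝ,
        (∀ n x y, CondDensity.IsMLE F x y (mle n x y)) →
        ∀ M : NNReal, ∀ᶠ n : ℕ in atTop,
          (M : ℝ≥0∞) * CondDensity.minimaxRisk F n <
            CondDensity.klRisk (mle n) CondDensity.unif (fun _ => 1 / 2)) := by
  obtain ⟨F, hconvex, hholder, hhalf, hmle, hlow, ⟨K, hK, hup⟩, c, hc, hkl⟩ :=
    theorem6_general γ ⟨hγ.1, by linarith [hγ.2]⟩
  have hrate : γ < 2 * γ / (2 * γ + 1) := by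
    rw [lt_div_iff₀ (by linarith [hγ.1])]
    nlinarith [hγ.1, hγ.2]
  refine ⟨F, hconvex, hholder, hhalf, hmle, fun δ hδ => ?_, ⟨K, hK, hup⟩, fun mle h M => ?_⟩
  · obtain ⟨C, hC, hliminf⟩ := hlow δ hδ
    exact ⟨C, hC, hliminf.trans
      (CondDensity.liminf_innerProb_le_liminf_innerProb_log F hγ.1.le hC.le)⟩
  · exact CondDensity.eventually_mul_lt_of_le_rpow_of_rpow_le hrate hc hup
      (hkl.mono fun n hn => hn (mle n) (h n)) M
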